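/- Let $T>0$ and let $\Gamma_0\subset\mathbb{R}^{n+1}$ be a closed (compact, without boundary) smooth hypersurface, transported by a smooth map $\Phi:\Gamma_0\times[0,T]\to\mathbb{R}^{n+1}$ with $\Phi(\cdot,0)=\mathrm{Id}$ such that for every $t\in[0,T]$ the map $\Phi(\cdot,t)$ is a diffeomorphism of $\Gamma_0$ onto $\Gamma(t)=\Phi(\Gamma_0,t)$. Let $v(\cdot,t)=\partial_t\Phi(\cdot,t)\circ\Phi(\cdot,t)^{-1}$ be the velocity, $G_T=\bigcup_{t\in(0,T)}\Gamma(t)\times\{t\}$, let $\nabla_\Gamma$ and $\nabla_\Gamma\cdot$ denote the tangential gradient and divergence on $\Gamma(t)$, and $\dot g=\partial_t g+v\cdot\nabla g$ the material derivative. Let the flux $f=f((x,t),s)\in\mathbb{R}^{n+1}$, given for $t\in[0,T]$, $x\in\Gamma(t)$, $s\in\mathbb{R}$, be smooth with all derivatives (of order at least one) bounded, tangential to $\Gamma(t)$ at $x$, and such that $\nabla_\Gamma\cdot f((\cdot,t),s)=0$ on $\Gamma(t)$ for all fixed $t$ and $s$. Let $u_0\in L^\infty(\Gamma_0)$. A function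 $u\in L^\infty(G_T)$ is called an entropy solution of $\dot u+u\,\nabla_\Gamma\cdot v+\nabla_\Gamma\cdot f(\cdot,u)=0$ on $G_T$, $u(\cdot,0)=u_0$ on $\Gamma_0$, if $$-\int_{\Gamma_0}\eta(u_0)\,\phi(\cdot,0)+\int_0^T\int_{\Gamma(t)}\Big(-\eta(u)\,\dot\phi-q(\cdot,u)\cdot\nabla_\Gamma\phi+\phi\,\nabla_\Gamma\cdot v\,\big(u\,\eta'(u)-\eta(u)\big)\Big)\,dt\le 0$$ for all $\eta\in C^2(\mathbb{R})$ with $\eta''\ge 0$, all $s_0\in\mathbb{R}$, with $q(\cdot,s)=\int_{s_0}^s\eta'(\tau)\,\partial_u f(\cdot,\tau)\,d\tau$, and all $\phi\in H^1(G_T)$ with $\phi\ge 0$ and $\phi(\cdot,T)=0$ (traces at $t=0$ and $t=T$). Then for every entropy solution $u$ (more precisely, for every function representing it) there is a set $\mathcal E\subset[0,T]$ of Lebesgue measure zero such that $x\mapsto|u(\Phi(x,t),t)-u_0(x)|^2$ is integrable on $\Gamma_0$ for every $t\in[0,T]\setminus\mathcal E$, and $$\lim_{\substack{t\to 0\\ t\in[0,T]\setminus\mathcal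 E}}\int_{\Gamma_0}|u(\Phi(x,t),t)-u_0(x)|^2=0.$$ -/

import Mathlib

open MeasureTheory Set Filter Topology
open scoped ContDiff ENNReal

noncomputable section

/-- The ambient Euclidean space `ℝⁿ⁺¹`. -/
abbrev Amb (n : ℕ) : Type := EuclideanSpace ℝ (Fin (n + 1))

/-! ### Hypersurfaces and tangential calculus -/

/-- A closed (compact, without boundary) smooth hypersurface of `ℝⁿ⁺¹`: a compact set which near
each of its points is the zero set of a smooth function with nonvanishing differential. -/
def IsClosedSmoothHypersurface {n : ℕ} (S : Set (Amb n)) : Prop :=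
  IsCompact S ∧ ∀ p ∈ S, ∃ (U : Set (Amb n)) (F : Amb n → ℝ),
    IsOpen U ∧ p ∈ U ∧ ContDiffOn ℝ ∞ F U ∧ (∀ x ∈ U, fderiv ℝ F x ≠ 0) ∧
      S ∩ U = {x ∈ U | F x = 0}

/-- A map on an arbitrary subset `S` of a normed space is smooth if it is the restriction to `S`
of a smooth map on the whole space. (All sets to which this is applied are compact, so by a
partition of unity it is the same to ask for smooth extensions near every point of `S`.) -/
def SmoothOnSubset {X Y : Type*} [NormedAddCommGroup X] [NormedSpace ℝ X]
    [NormedAddCommGroup Y] [NormedSpace ℝ Y] (g : X → Y) (S : Set X) : Prop :=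
  ∃ G : X → Y, ContDiff ℝ ∞ G ∧ EqOn g G S

/-- The tangent space of `S` at `y`. -/
def tangentSpaceAt {n : ℕ} (S : Set (Amb n)) (y : Amb n) : Submodule ℝ (Amb n) :=
  Submodule.span ℝ (tangentConeAt ℝ S y)

/-- The orthogonal projection onto the tangent space, `P = I - ν ⊗ ν` for a hypersurface with
unit normal `ν`. -/
def tangentProj {n : ℕ} (S : Set (Amb n)) (y : Amb n) : Amb n →L[ℝ] Amb n :=
  (tangentSpaceAt S y).starProjection

/-- The tangential gradient `∇_S g = ∇g - (∇g · ν) ν` of a function `g` defined near `S`. -/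
def tangentialGrad {n : ℕ} (S : Set (Amb n)) (g : Amb n → ℝ) (y : Amb n) : Amb n :=
  tangentProj S y (gradient g y)

/-- The tangential divergence `∇_S · w = ∑ⱼ Dⱼ wⱼ = tr (P Dw)` of a vector field `w` on `S`.
The value depends only on the action of `Dw` on the tangent space, hence
neither on the values of `w` outside `S` nor on the choice made by `fderivWithin`. -/
def tangentialDiv {n : ℕ} (S : Set (Amb n)) (w : Amb n → Amb n) (y : Amb n) : ℝ :=
  LinearMap.trace ℝ (Amb n)
    ((tangentProj S y ∘L fderivWithin ℝ w S y ∘L tangentProj S y : Amb n →L[ℝ] Amb n) :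
      Amb n →ₗ[ℝ] Amb n)

/-- Integration over `n`-dimensional surfaces in `ℝⁿ⁺¹`: the `n`-dimensional Hausdorff measure,
normalised so as to be the usual surface measure. -/
def surfMeas (n : ℕ) : Measure (Amb n) := μHE[n]

/-! ### The moving hypersurface -/

/-- The surface `Γ(t) = Φ(Γ₀, t)`. -/
def surf {n : ℕ} (Γ₀ : Set (Amb n)) (Φ : Amb n → ℝ → Amb n) (t : ℝ) : Set (Amb n) :=
  (fun x => Φ x t) '' Γ₀

/-- `Γ₀` is a closed smooth hypersurface, transported by a smooth map `Φ : Γ₀ × [0,T] → ℝⁿ⁺¹` with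
`Φ(·,0) = id` such that every `Φ(·,t)` is a diffeomorphism of `Γ₀` onto `Γ(t) = Φ(Γ₀,t)`
(a smooth map with a smooth inverse; `Γ(t)` is then a closed smooth hypersurface, too). -/
structure IsMovingHypersurface {n : ℕ} (T : ℝ) (Γ₀ : Set (Amb n)) (Φ : Amb n → ℝ → Amb n) :
    Prop where
  hypersurface : IsClosedSmoothHypersurface Γ₀
  smooth : SmoothOnSubset (fun p : Amb n × ℝ => Φ p.1 p.2) (Γ₀ ×ˢ Icc 0 T)
  initial : ∀ x ∈ Γ₀, Φ x 0 = x
  diffeo : ∀ t ∈ Icc (0 : ℝ) T, ∃ Ψ : Amb n → Amb n,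
    SmoothOnSubset Ψ (surf Γ₀ Φ t) ∧ ∀ x ∈ Γ₀, Ψ (Φ x t) = x

/-- The velocity `v(·,t) = ∂ₜΦ(·,t) ∘ Φ(·,t)⁻¹` of the material points, on `Γ(t)`, `t ∈ [0,T]`. -/
def velocity {n : ℕ} (T : ℝ) (Γ₀ : Set (Amb n)) (Φ : Amb n → ℝ → Amb n) (y : Amb n) (t : ℝ) :
    Amb n :=
  derivWithin (fun s => Φ (Function.invFunOn (fun x => Φ x t) Γ₀ y) s) (Icc 0 T) t

/-- The flux `f = f((y,t),s)`: smooth on `{(y,t,s) : t ∈ [0,T], y ∈ Γ(t), s ∈ ℝ}` with bounded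
derivatives of all orders, tangential to `Γ(t)`, and tangentially divergence free for fixed
`t` and `s`. -/
structure IsFlux {n : ℕ} (T : ℝ) (Γ₀ : Set (Amb n)) (Φ : Amb n → ℝ → Amb n)
    (f : Amb n → ℝ → ℝ → Amb n) : Prop where
  smooth : ∃ G : Amb n × ℝ × ℝ → Amb n, ContDiff ℝ ∞ G ∧
    (∀ t ∈ Icc (0 : ℝ) T, ∀ y ∈ surf Γ₀ Φ t, ∀ s : ℝ, f y t s = G (y, t, s)) ∧
    ∀ k : ℕ, 1 ≤ k → ∃ C : ℝ, ∀ t ∈ Icc (0 : ℝ) T, ∀ y ∈ surf Γ₀ Φ t, ∀ s : ℝ,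
      ‖iteratedFDeriv ℝ k G (y, t, s)‖ ≤ C
  tangential : ∀ t ∈ Icc (0 : ℝ) T, ∀ y ∈ surf Γ₀ Φ t, ∀ s : ℝ,
    f y t s ∈ tangentSpaceAt (surf Γ₀ Φ t) y
  div_free : ∀ t ∈ Icc (0 : ℝ) T, ∀ y ∈ surf Γ₀ Φ t, ∀ s : ℝ,
    tangentialDiv (surf Γ₀ Φ t) (fun z => f z t s) y = 0

/-! ### Function spaces on the space-time surface `G_T = ⋃_{t ∈ (0,T)} Γ(t) × {t}` -/

/-- The product of surface measure on `Γ₀` and Lebesgue measure on `(0,T)`. -/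
def refMeas {n : ℕ} (T : ℝ) (Γ₀ : Set (Amb n)) : Measure (Amb n × ℝ) :=
  ((surfMeas n).restrict Γ₀).prod (volume.restrict (Ioo 0 T))

/-- The pull-back `(x,t) ↦ g(Φ(x,t),t)` to `Γ₀ × (0,T)` of a function `g` on `G_T`. -/
def pullback {n : ℕ} {Y : Type*} (Φ : Amb n → ℝ → Amb n) (g : Amb n → ℝ → Y) :
    Amb n × ℝ → Y :=
  fun p => g (Φ p.1 p.2) p.2

/-- `u ∈ L^∞(G_T)`. Since `(x,t) ↦ (Φ(x,t),t)` is a diffeomorphism of `Γ₀ × [0,T]` onto the closure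
of `G_T`, null sets, measurability and essential bounds may be read off from the pull-back. -/
def IsLInftyGT {n : ℕ} (T : ℝ) (Γ₀ : Set (Amb n)) (Φ : Amb n → ℝ → Amb n)
    (u : Amb n → ℝ → ℝ) : Prop :=
  MemLp (pullback Φ u) ∞ (refMeas T Γ₀)

/-- The material derivative `∂ₜF + v · ∇F` of a function `F` on space-time. -/
def materialDeriv {n : ℕ} (T : ℝ) (Γ₀ : Set (Amb n)) (Φ : Amb n → ℝ → Amb n)
    (F : Amb n × ℝ → ℝ) (y : Amb n) (t : ℝ) : ℝ :=
  fderiv ℝ F (y, t) (velocity T Γ₀ Φ y t, 1)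

/-- `φ ∈ H¹(G_T)` with weak material derivative `φdot`, weak tangential gradient `φgrad`, and with
traces `φ(·,0) = φ₀` and `φ(Φ(·,T),T) = φT` on `Γ₀`. The space `H¹(G_T)` is the completion of the
`C¹` functions in the norm `(‖φ‖² + ‖φdot‖² + ‖∇_Γ φ‖²)^{1/2}`, with `L²` norms over `G_T`; these
norms are equivalent to those of the pull-backs over `Γ₀ × (0,T)`, which are used here.
The traces at `t = 0` and `t = T` are continuous with respect to this norm, so they are the `L²`
limits of the traces of any approximating sequence. -/
structure IsH1GT {n : ℕ} (T : ℝ) (Γ₀ : Set (Amb n)) (Φ : Amb n → ℝ → Amb n)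
    (φ φdot : Amb n → ℝ → ℝ) (φgrad : Amb n → ℝ → Amb n) (φ₀ φT : Amb n → ℝ) : Prop where
  meas : AEStronglyMeasurable (pullback Φ φ) (refMeas T Γ₀)
  meas_dot : AEStronglyMeasurable (pullback Φ φdot) (refMeas T Γ₀)
  meas_grad : AEStronglyMeasurable (pullback Φ φgrad) (refMeas T Γ₀)
  meas_zero : AEStronglyMeasurable φ₀ ((surfMeas n).restrict Γ₀)
  meas_end : AEStronglyMeasurable φT ((surfMeas n).restrict Γ₀)
  approx : ∃ F : ℕ → Amb n × ℝ → ℝ, (∀ k, ContDiff ℝ 1 (F k)) ∧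
    Tendsto (fun k => eLpNorm (pullback Φ fun y t => F k (y, t) - φ y t) 2 (refMeas T Γ₀))
      atTop (𝓝 0) ∧
    Tendsto (fun k => eLpNorm
      (pullback Φ fun y t => materialDeriv T Γ₀ Φ (F k) y t - φdot y t) 2 (refMeas T Γ₀))
      atTop (𝓝 0) ∧
    Tendsto (fun k => eLpNorm (pullback Φ fun y t =>
      tangentialGrad (surf Γ₀ Φ t) (fun z => F k (z, t)) y - φgrad y t) 2 (refMeas T Γ₀))
      atTop (𝓝 0) ∧
    Tendsto (fun k => eLpNorm (fun x => F k (x, 0) - φ₀ x) 2 ((surfMeas n).restrict Γ₀))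
      atTop (𝓝 0) ∧
    Tendsto (fun k => eLpNorm (fun x => F k (Φ x T, T) - φT x) 2 ((surfMeas n).restrict Γ₀))
      atTop (𝓝 0)

/-! ### Entropy solutions -/

/-- The entropy flux `q(y,t,s) = ∫_{s₀}^s η'(τ) ∂ᵤf((y,t),τ) dτ`. -/
def entropyFlux {n : ℕ} (f : Amb n → ℝ → ℝ → Amb n) (η : ℝ → ℝ) (s₀ : ℝ) (y : Amb n) (t s : ℝ) :
    Amb n :=
  ∫ τ in s₀..s, deriv η τ • deriv (fun r => f y t r) τ

/-- `u ∈ L^∞(G_T)` is an entropy solution of `u̇ + u ∇_Γ·v + ∇_Γ·f(·,u) = 0` with initial value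
`u₀`. -/
def IsEntropySolution {n : ℕ} (T : ℝ) (Γ₀ : Set (Amb n)) (Φ : Amb n → ℝ → Amb n)
    (f : Amb n → ℝ → ℝ → Amb n) (u₀ : Amb n → ℝ) (u : Amb n → ℝ → ℝ) : Prop :=
  IsLInftyGT T Γ₀ Φ u ∧
  ∀ η : ℝ → ℝ, ContDiff ℝ 2 η → (∀ s, 0 ≤ deriv (deriv η) s) → ∀ s₀ : ℝ,
  ∀ (φ φdot : Amb n → ℝ → ℝ) (φgrad : Amb n → ℝ → Amb n) (φ₀ φT : Amb n → ℝ),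
    IsH1GT T Γ₀ Φ φ φdot φgrad φ₀ φT →
    (∀ᵐ p ∂(refMeas T Γ₀), 0 ≤ pullback Φ φ p) →
    (∀ᵐ x ∂((surfMeas n).restrict Γ₀), φT x = 0) →
    -(∫ x in Γ₀, η (u₀ x) * φ₀ x ∂(surfMeas n)) +
      (∫ t in Ioo 0 T, ∫ y in surf Γ₀ Φ t,
        (-(η (u y t) * φdot y t) - inner ℝ (entropyFlux f η s₀ y t (u y t)) (φgrad y t) +
          φ y t * tangentialDiv (surf Γ₀ Φ t) (fun z => velocity T Γ₀ Φ z t) y *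
            (u y t * deriv η (u y t) - η (u y t))) ∂(surfMeas n)) ≤ 0

end

noncomputable section

open ProbabilityTheory

/-! ### Hausdorff measure and Lipschitz maps -/

/-! Strong attainment of the initial value follows from two instances of the entropy inequality: an
upper bound for the norm and a one-sided weak bound together give strong convergence in `L²`.

Test with `φ(y,t) = ψ(y) ζ(t)`, where `ψ ≥ 0` is `C¹` and `ζ(t) = ∫_t^δ r` with a free continuous `r
≥ 0` vanishing beyond a short time `δ`. Since `ζ' = -r` and all terms without `ζ'` are bounded by a
constant times `ζ`, varying `r` gives, for almost every small `t`, that `∫_{Γ(t)} η(u) ψ ≤ ∫_{Γ₀}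
η(u₀) ψ + C t` (`IsEntropySolution.setIntegral_le`, `IsEntropySolution.ae_integral_le`).

Let `M` bound `|u|` and `|u₀|`, and put `p = u + M`, `p₀ = u₀ + M ≥ 0`. The entropy `(s + M)²` with
`ψ = 1` bounds `∫ p²` by `∫ p₀² + C t`. The entropy `-(s + M)` with a smooth `ψ ≥ 0` close to `p₀`
in `L¹` bounds `-∫ p ψ` by `-∫ p₀ ψ + C t`; the shift by `M` is what makes a nonnegative `ψ`
possible. Expanding `(p - p₀)²` leaves an error which is small at `t = 0` (`integral_sq_sub_le`).
Only countably many accuracies are needed, so the exceptional null sets can be united.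

The geometric input is needed only on a short time interval (`ShortTimeFlow`). The surface measures
of `Γ(t)`, pulled back to `Γ₀`, are compared with that of `Γ₀` up to the factor `(1 + C t)^n` by
Lipschitz bounds for Hausdorff measure, without Jacobians. Tangential projections and `∇_Γ · v` are
shown to be jointly continuous in space and time, which bounds the remaining terms of the entropy
inequality and makes them measurable. -/

theorem euclideanHausdorffMeasure_image_le {X Y : Type*} [MetricSpace X]
    [MeasurableSpace X] [BorelSpace X] [MetricSpace Y] [MeasurableSpace Y] [BorelSpace Y]
    {f : X → Y} {s : Set X} {K : NNReal} (h : LipschitzOnWith K f s) (d : ℕ) :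
    μHE[d] (f '' s) ≤ (K : ℝ≥0∞) ^ d * μHE[d] s := by
  have := h.hausdorffMeasure_image_le (d := d) (by positivity)
  simp only [Measure.euclideanHausdorffMeasure_def, Measure.smul_apply, ENNReal.smul_def,
    smul_eq_mul]
  rw [ENNReal.rpow_natCast] at this
  calc _ ≤ _ := mul_le_mul_right this _
    _ = _ := by ring

/-- The distance bound forces `f` to be constant on the fibres of `g` in `s`, so `f` factors through
`g` by a `K`-Lipschitz map on `g '' s`. -/
theorem euclideanHausdorffMeasure_image_le_image {ι X Y : Type*} [MetricSpace X]
    [MeasurableSpace X] [BorelSpace X] [MetricSpace Y] [MeasurableSpace Y] [BorelSpace Y]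
    {f : ι → X} {g : ι → Y} {s : Set ι} {K : NNReal}
    (h : ∀ a ∈ s, ∀ b ∈ s, dist (f a) (f b) ≤ K * dist (g a) (g b)) (d : ℕ) :
    μHE[d] (f '' s) ≤ (K : ℝ≥0∞) ^ d * μHE[d] (g '' s) := by
  rcases s.eq_empty_or_nonempty with rfl | ⟨a₀, -⟩
  · simp
  have : Nonempty ι := ⟨a₀⟩
  set k : Y → X := fun y => f (Function.invFunOn g s y)
  have hinv : ∀ a ∈ s, Function.invFunOn g s (g a) ∈ s ∧ g (Function.invFunOn g s (g a)) = g a :=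
    fun a ha => ⟨Function.invFunOn_mem ⟨a, ha, rfl⟩, Function.invFunOn_eq ⟨a, ha, rfl⟩⟩
  have hk : ∀ a ∈ s, k (g a) = f a := by
    intro a ha
    have := h _ (hinv a ha).1 a ha
    rw [(hinv a ha).2, dist_self, mul_zero] at this
    exact dist_le_zero.1 this
  have himg : f '' s = k '' (g '' s) := by
    rw [image_image]
    exact image_congr fun a ha => (hk a ha).symm
  rw [himg]
  refine euclideanHausdorffMeasure_image_le (LipschitzOnWith.of_dist_le_mul ?_) d
  rintro _ ⟨a, ha, rfl⟩ _ ⟨b, hb, rfl⟩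
  rw [hk a ha, hk b hb]
  exact h a ha b hb

/-! ### Level sets -/

section LevelSet

variable {n : ℕ} {S U : Set (Amb n)} {F : Amb n → ℝ} {p : Amb n}

/-- Since `F` vanishes on `S ∩ U`, both `F'` and `0` are derivatives of `F` within this set, and
they must agree on tangent vectors. Conversely, the implicit function theorem parametrizes `S` near
`p` over the kernel, with the inclusion as derivative. -/
theorem tangentSpaceAt_eq_ker {F' : Amb n →L[ℝ] ℝ} (hU : IsOpen U)
    (hpU : p ∈ U) (hS : S ∩ U = {x ∈ U | F x = 0}) (hp : p ∈ S)
    (hF : HasStrictFDerivAt F F' p) (hF' : F' ≠ 0) :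
    tangentSpaceAt S p = LinearMap.ker (F' : Amb n →ₗ[ℝ] ℝ) := by
  have hzero : ∀ x ∈ S ∩ U, F x = 0 := fun x hx => by rw [hS] at hx; exact hx.2
  have hsurj : F'.range = ⊤ := by
    refine LinearMap.range_eq_top.2 (LinearMap.surjective ?_)
    exact fun h => hF' (ContinuousLinearMap.coe_injective h)
  apply le_antisymm
  · refine Submodule.span_le.2 fun w hw => ?_
    rw [← tangentConeAt_inter_nhds (hU.mem_nhds hpU)] at hw
    have h0 : HasFDerivWithinAt F (0 : Amb n →L[ℝ] ℝ) (S ∩ U) p :=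
      (hasFDerivWithinAt_const (0 : ℝ) p (S ∩ U)).congr hzero (hzero p ⟨hp, hpU⟩)
    exact hF.hasFDerivAt.hasFDerivWithinAt.unique_on h0 hw
  · intro v hv
    set g := hF.implicitFunction F F' hsurj (F p)
    have hg : HasStrictFDerivAt g F'.ker.subtypeL 0 := hF.to_implicitFunction hsurj
    have hg0 : g 0 = p := hF.implicitFunction_apply_image hsurj
    have h1 : ∀ᶠ z in 𝓝 (0 : F'.ker), F (g z) = F p := by
      have := hF.map_implicitFunction_eq hsurj
      rw [nhds_prod_eq] at this
      exact this.curry.self_of_nhds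
    have h2 : ∀ᶠ z in 𝓝 (0 : F'.ker), g z ∈ U :=
      hg.hasFDerivAt.continuousAt.eventually_mem (by rw [hg0]; exact hU.mem_nhds hpU)
    have hW : {z | g z ∈ S} ∈ 𝓝 (0 : F'.ker) := by
      filter_upwards [h1, h2] with z hz1 hz2
      have : g z ∈ {x ∈ U | F x = 0} := ⟨hz2, hz1.trans (hzero p ⟨hp, hpU⟩)⟩
      rw [← hS] at this
      exact this.1
    have hmap := (hg.hasFDerivAt.hasFDerivWithinAt (s := {z | g z ∈ S})).mapsTo_tangent_cone
    have hv' : (⟨v, hv⟩ : F'.ker) ∈ tangentConeAt ℝ {z | g z ∈ S} (0 : F'.ker) := by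
      rw [tangentConeAt_of_mem_nhds hW]; trivial
    have := hmap hv'
    rw [hg0] at this
    exact Submodule.subset_span (tangentConeAt_mono (image_subset_iff.2 fun z hz => hz) this)

theorem ker_eq_orthogonal_gradient :
    LinearMap.ker (fderiv ℝ F p : Amb n →ₗ[ℝ] ℝ) = (ℝ ∙ gradient F p)ᗮ := by
  ext w
  rw [Submodule.mem_orthogonal_singleton_iff_inner_right, LinearMap.mem_ker,
    gradient, InnerProductSpace.toDual_symm_apply]
  rfl

theorem gradient_ne_zero (h : fderiv ℝ F p ≠ 0) : gradient F p ≠ 0 := by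
  simpa [gradient] using h

theorem tangentProj_eq_sub {N : Amb n}
    (h : tangentSpaceAt S p = (ℝ ∙ N)ᗮ) :
    tangentProj S p = ContinuousLinearMap.id ℝ (Amb n) -
      (‖N‖ ^ 2)⁻¹ • (innerSL ℝ N).smulRight N := by
  unfold tangentProj
  rw [show (tangentSpaceAt S p).starProjection = ((ℝ ∙ N)ᗮ).starProjection by congr!]
  ext1 w
  rw [Submodule.starProjection_orthogonal']
  simp [Submodule.starProjection_singleton, smul_smul, div_eq_inv_mul]

/-- Strict differentiability makes the normal component of a short chord of `S` near `p` at most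
half its length. Hence the inverse of the projection to the tangent plane is locally 2-Lipschitz,
and the area is at most `2 ^ n` times the volume of a bounded set in an `n`-dimensional Euclidean
space. -/
theorem finiteAtFilter_levelSet (hU : IsOpen U)
    (hpU : p ∈ U) (hS : S ∩ U = {x ∈ U | F x = 0}) (hSb : Bornology.IsBounded S)
    (hF : HasStrictFDerivAt F (fderiv ℝ F p) p) (hF' : fderiv ℝ F p ≠ 0) :
    (surfMeas n).FiniteAtFilter (𝓝[S] p) := by
  set N := gradient F p
  have hN : N ≠ 0 := gradient_ne_zero hF'
  have hNpos : 0 < ‖N‖ := norm_pos_iff.2 hN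
  have hNin : ∀ w, fderiv ℝ F p w = inner ℝ N w := fun w => by
    simp [N, gradient, InnerProductSpace.toDual_symm_apply]
  have hzero : ∀ x ∈ S ∩ U, F x = 0 := fun x hx => by rw [hS] at hx; exact hx.2
  set V : Submodule ℝ (Amb n) := (ℝ ∙ N)ᗮ
  have hdim : Module.finrank ℝ V = n := by
    have : Fact (Module.finrank ℝ (Amb n) = n + 1) := ⟨by simp⟩
    exact Submodule.finrank_orthogonal_span_singleton hN
  have hev := hF.isLittleO.def (half_pos hNpos)
  rw [nhds_prod_eq, Filter.eventually_prod_self_iff'] at hev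
  obtain ⟨W, hW, hWF⟩ := hev
  refine ⟨S ∩ (U ∩ W), inter_mem_nhdsWithin S (inter_mem (hU.mem_nhds hpU) hW), ?_⟩
  have hle : μHE[n] (id '' (S ∩ (U ∩ W))) ≤ ((2 : NNReal) : ℝ≥0∞) ^ n *
      μHE[n] (V.orthogonalProjectionOnto '' (S ∩ (U ∩ W))) := by
    refine euclideanHausdorffMeasure_image_le_image (fun a ha b hb => ?_) n
    have h1 := hWF a ha.2.2 b hb.2.2
    simp only [hzero a ⟨ha.1, ha.2.1⟩, hzero b ⟨hb.1, hb.2.1⟩, sub_self, zero_sub, norm_neg,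
      hNin] at h1
    set w := a - b
    have h2 : V.starProjection w = w - (inner ℝ N w / ‖N‖ ^ 2) • N := by
      rw [Submodule.starProjection_orthogonal']
      simp [Submodule.starProjection_singleton]
    have h3 : ‖w‖ ≤ ‖V.starProjection w‖ + ‖w‖ / 2 := by
      have h4 : w = V.starProjection w + (inner ℝ N w / ‖N‖ ^ 2) • N := by rw [h2]; abel
      have h5 : ‖(inner ℝ N w / ‖N‖ ^ 2) • N‖ ≤ ‖w‖ / 2 := by
        rw [norm_smul, norm_div, norm_pow, norm_norm, div_mul_eq_mul_div,
          div_le_iff₀ (by positivity)]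
        calc _ ≤ ‖N‖ / 2 * ‖w‖ * ‖N‖ := by gcongr
          _ = _ := by ring
      calc ‖w‖ = ‖V.starProjection w + (inner ℝ N w / ‖N‖ ^ 2) • N‖ := by rw [← h4]
        _ ≤ _ := (norm_add_le _ _).trans (by gcongr)
    have h6 : dist (V.orthogonalProjectionOnto a) (V.orthogonalProjectionOnto b) =
        ‖V.starProjection w‖ := by
      rw [dist_eq_norm, ← map_sub]
      rfl
    rw [h6, id, id, dist_eq_norm]
    change ‖w‖ ≤ 2 * _
    linarith
  rw [image_id] at hle
  refine hle.trans_lt (ENNReal.mul_lt_top (by simp) ?_)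
  have hvol : (μHE[n] : Measure V) = volume := by
    rw [← InnerProductSpace.euclideanHausdorffMeasure_eq_volume, hdim]
  rw [hvol]
  have hb : Bornology.IsBounded (V.orthogonalProjectionOnto '' S) :=
    V.orthogonalProjectionOnto.lipschitz.isBounded_image hSb
  exact (hb.subset (image_mono inter_subset_left)).measure_lt_top

end LevelSet

/-! ### Closed hypersurfaces: finite area and continuity of the tangential projection. -/

namespace IsClosedSmoothHypersurface

variable {n : ℕ} {S : Set (Amb n)}

theorem surfMeas_lt_top (h : IsClosedSmoothHypersurface S) : surfMeas n S < ⊤ := by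
  refine h.1.measure_lt_top_of_nhdsWithin fun p hp => ?_
  obtain ⟨U, F, hU, hpU, hF, hF', hS⟩ := h.2 p hp
  exact finiteAtFilter_levelSet hU hpU hS h.1.isBounded
    ((hF.contDiffAt (hU.mem_nhds hpU)).hasStrictFDerivAt (by simp)) (hF' p hpU)

theorem continuousOn_tangentProj (h : IsClosedSmoothHypersurface S) :
    ContinuousOn (tangentProj S) S := by
  intro p hp
  obtain ⟨U, F, hU, hpU, hF, hF', hS⟩ := h.2 p hp
  have heq : ∀ x ∈ S ∩ U, tangentProj S x = ContinuousLinearMap.id ℝ (Amb n) -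
      (‖gradient F x‖ ^ 2)⁻¹ • (innerSL ℝ (gradient F x)).smulRight (gradient F x) := by
    intro x hx
    have hFx := hF.contDiffAt (hU.mem_nhds hx.2)
    apply tangentProj_eq_sub
    rw [tangentSpaceAt_eq_ker hU hx.2 hS hx.1 (hFx.hasStrictFDerivAt (by simp)) (hF' x hx.2),
      ker_eq_orthogonal_gradient]
  have hgrad : ContinuousAt (gradient F) p := by
    have h1 : ContinuousAt (fderiv ℝ F) p :=
      ((hF.contDiffAt (hU.mem_nhds hpU)).fderiv_right (m := 0) (by simp)).continuousAt
    exact (InnerProductSpace.toDual ℝ (Amb n)).symm.continuous.continuousAt.comp h1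
  have hN : ‖gradient F p‖ ^ 2 ≠ 0 := by simpa using gradient_ne_zero (hF' p hpU)
  have hsr : Continuous fun N : Amb n => (innerSL ℝ N).smulRight N := by
    have h1 : Continuous fun N : Amb n => ContinuousLinearMap.smulRightL ℝ (Amb n) (Amb n)
        (innerSL ℝ N) N := by fun_prop
    exact h1
  have hcont : ContinuousAt (fun x => ContinuousLinearMap.id ℝ (Amb n) -
      (‖gradient F x‖ ^ 2)⁻¹ • (innerSL ℝ (gradient F x)).smulRight (gradient F x)) p := by
    refine continuousAt_const.sub (((hgrad.norm.pow 2).inv₀ hN).smul ?_)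
    exact hsr.continuousAt.comp hgrad
  refine hcont.continuousWithinAt.congr_of_eventuallyEq ?_ (heq p ⟨hp, hpU⟩)
  filter_upwards [inter_mem_nhdsWithin S (hU.mem_nhds hpU)] with x hx using heq x hx

end IsClosedSmoothHypersurface

/-! ### Orthogonal projections onto ranges of idempotents -/

section Idempotent

variable {E : Type*} [NormedAddCommGroup E] [InnerProductSpace ℝ E] [FiniteDimensional ℝ E]

/-- Let `P` be the orthogonal projection onto `V`. From `PQ = Q` and `QP = P` one gets `PQ* = P`,
hence `P(Q + Q* - 1) = Q`. A vector `w` killed by `Q + Q* - 1` thus satisfies `Qw = 0` and `w =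
Q*w`, so `⟨w, w⟩ = ⟨w, Qw⟩ = 0`. The resulting formula for `P` transfers continuity from oblique to
orthogonal projections. -/
theorem isUnit_add_adjoint_sub_one {Q : E →L[ℝ] E} {V : Submodule ℝ E}
    (hmem : ∀ w, Q w ∈ V) (hid : ∀ w ∈ V, Q w = w) :
    IsUnit (Q + ContinuousLinearMap.adjoint Q - 1) ∧
      V.starProjection * (Q + ContinuousLinearMap.adjoint Q - 1) = Q := by
  have : CompleteSpace E := FiniteDimensional.complete ℝ E
  have h1 : V.starProjection * Q = Q := by
    ext w
    exact Submodule.starProjection_eq_self_iff.2 (hmem w)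
  have h2 : Q * V.starProjection = V.starProjection := by
    ext w
    exact hid _ (Submodule.starProjection_apply_mem V w)
  have h3 : V.starProjection * ContinuousLinearMap.adjoint Q = V.starProjection := by
    have := congrArg ContinuousLinearMap.adjoint h2
    rw [ContinuousLinearMap.mul_def, ContinuousLinearMap.adjoint_comp,
      (ContinuousLinearMap.isSelfAdjoint_iff'.1 (isSelfAdjoint_starProjection V))] at this
    exact this
  have h4 : V.starProjection * (Q + ContinuousLinearMap.adjoint Q - 1) = Q := by
    rw [mul_sub, mul_add, h1, h3, mul_one, add_sub_cancel_right]
  refine ⟨?_, h4⟩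
  have hinj : Function.Injective (Q + ContinuousLinearMap.adjoint Q - 1 : E →L[ℝ] E) := by
    refine (injective_iff_map_eq_zero _).2 fun w hw => ?_
    have hQ : Q w = 0 := by
      rw [← h4, mul_apply_eq_comp, hw, map_zero]
    have hw' : w = ContinuousLinearMap.adjoint Q w := by
      have : Q w + ContinuousLinearMap.adjoint Q w - w = 0 := hw
      rw [hQ, zero_add, sub_eq_zero] at this
      exact this.symm
    have : inner ℝ w w = (0 : ℝ) := by
      nth_rewrite 1 [hw']
      rw [ContinuousLinearMap.adjoint_inner_left, hQ, inner_zero_right]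
    exact inner_self_eq_zero.1 this
  rw [ContinuousLinearMap.isUnit_iff_bijective]
  exact ⟨hinj, LinearMap.surjective_of_injective (f := (Q + ContinuousLinearMap.adjoint Q - 1 :
    E →L[ℝ] E).toLinearMap) hinj⟩

theorem starProjection_eq_mul_inverse {Q : E →L[ℝ] E} {V : Submodule ℝ E}
    (hmem : ∀ w, Q w ∈ V) (hid : ∀ w ∈ V, Q w = w) :
    V.starProjection = Q * Ring.inverse (Q + ContinuousLinearMap.adjoint Q - 1) := by
  obtain ⟨hu, h⟩ := isUnit_add_adjoint_sub_one hmem hid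
  calc V.starProjection = V.starProjection * ((Q + ContinuousLinearMap.adjoint Q - 1) *
        Ring.inverse (Q + ContinuousLinearMap.adjoint Q - 1)) := by
        rw [Ring.mul_inverse_cancel _ hu, mul_one]
    _ = _ := by rw [← mul_assoc, h]

theorem ContinuousOn.starProjection_of_idempotent {X : Type*} [TopologicalSpace X] {K : Set X}
    {Q : X → E →L[ℝ] E} {V : X → Submodule ℝ E} (hQ : ContinuousOn Q K)
    (hmem : ∀ p ∈ K, ∀ w, Q p w ∈ V p) (hid : ∀ p ∈ K, ∀ w ∈ V p, Q p w = w) :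
    ContinuousOn (fun p => (V p).starProjection) K := by
  have : CompleteSpace E := FiniteDimensional.complete ℝ E
  have h : ContinuousOn (fun p => Q p *
      Ring.inverse (Q p + ContinuousLinearMap.adjoint (Q p) - 1)) K := by
    refine hQ.mul fun p hp => ?_
    have hu := (isUnit_add_adjoint_sub_one (hmem p hp) (hid p hp)).1
    have h1 : ContinuousWithinAt (fun p => Q p + ContinuousLinearMap.adjoint (Q p) - 1) K p :=
      ((hQ p hp).add (ContinuousLinearMap.adjoint.continuous.continuousAt.comp_continuousWithinAt
        (hQ p hp))).sub continuousWithinAt_const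
    have h2 := NormedRing.inverse_continuousAt hu.unit
    rw [hu.unit_spec] at h2
    exact ContinuousAt.comp_continuousWithinAt
      (f := fun p => Q p + ContinuousLinearMap.adjoint (Q p) - 1) h2 h1
  exact h.congr fun p hp => starProjection_eq_mul_inverse (hmem p hp) (hid p hp)

end Idempotent

/-! ### Derivatives of an extension of the flow -/

section Flow

variable {n : ℕ}

/-- The spatial derivative of a map on space-time. -/
def spaceDeriv (G : Amb n × ℝ → Amb n) (p : Amb n × ℝ) : Amb n →L[ℝ] Amb n :=
  fderiv ℝ G p ∘L ContinuousLinearMap.inl ℝ (Amb n) ℝ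

/-- The time derivative of a map on space-time. -/
def timeDeriv (G : Amb n × ℝ → Amb n) (p : Amb n × ℝ) : Amb n := fderiv ℝ G p (0, 1)

variable {G : Amb n × ℝ → Amb n}

theorem contDiff_spaceDeriv (hG : ContDiff ℝ ∞ G) : ContDiff ℝ ∞ (spaceDeriv G) := by
  unfold spaceDeriv
  exact (hG.fderiv_right (m := ∞) (by simp)).clm_comp contDiff_const

theorem contDiff_timeDeriv (hG : ContDiff ℝ ∞ G) : ContDiff ℝ ∞ (timeDeriv G) := by
  unfold timeDeriv
  exact (hG.fderiv_right (m := ∞) (by simp)).clm_apply contDiff_const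

theorem hasFDerivAt_spaceDeriv (hG : ContDiff ℝ ∞ G) (x : Amb n) (t : ℝ) :
    HasFDerivAt (fun z => G (z, t)) (spaceDeriv G (x, t)) x :=
  ((hG.differentiable (by simp)) (x, t)).hasFDerivAt.comp x (hasFDerivAt_prodMk_left x t)

theorem hasDerivAt_timeDeriv (hG : ContDiff ℝ ∞ G) (x : Amb n) (t : ℝ) :
    HasDerivAt (fun s => G (x, s)) (timeDeriv G (x, t)) t := by
  have h := ((hG.differentiable (by simp)) (x, t)).hasFDerivAt.comp t (hasFDerivAt_prodMk_right x t)
  simpa [timeDeriv, Function.comp_def] using h.hasDerivAt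

theorem exists_lipschitz_increment (hG : ContDiff ℝ ∞ G) {Γ : Set (Amb n)} (hΓ : IsCompact Γ)
    (T : ℝ) : ∃ C : ℝ, 0 ≤ C ∧
      (∀ x ∈ Γ, ∀ s ∈ Icc 0 T, ∀ t ∈ Icc 0 T,
        ‖spaceDeriv G (x, s) - spaceDeriv G (x, t)‖ ≤ C * |s - t|) ∧
      (∀ x ∈ Γ, ∀ s ∈ Icc 0 T, ∀ t ∈ Icc 0 T, ‖G (x, s) - G (x, t)‖ ≤ C * |s - t|) ∧
      ∀ x ∈ Γ, ∀ y ∈ Γ, ∀ s ∈ Icc 0 T, ∀ t ∈ Icc 0 T,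
        ‖(G (x, s) - G (x, t)) - (G (y, s) - G (y, t))‖ ≤ C * |s - t| * ‖x - y‖ := by
  -- The mean value inequality for `G(·,s) - G(·,t)` needs a convex domain, so `Γ` is enclosed in a
  -- ball.
  obtain ⟨R, hR⟩ := hΓ.isBounded.subset_closedBall (0 : Amb n)
  have hK : IsCompact (Metric.closedBall (0 : Amb n) R ×ˢ Icc 0 T) :=
    (isCompact_closedBall _ _).prod isCompact_Icc
  have hlip : ∀ {Y : Type} [NormedAddCommGroup Y] [NormedSpace ℝ Y] (H : Amb n × ℝ → Y),
      ContDiff ℝ ∞ H → ∃ C : NNReal, ∀ x ∈ Metric.closedBall (0 : Amb n) R, ∀ s ∈ Icc 0 T,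
        ∀ t ∈ Icc 0 T, ‖H (x, s) - H (x, t)‖ ≤ C * |s - t| := by
    intro Y _ _ H hH
    obtain ⟨C, hC⟩ := ((hH.of_le (by simp)).locallyLipschitz.locallyLipschitzOn
      (s := Metric.closedBall (0 : Amb n) R ×ˢ Icc 0 T)).exists_lipschitzOnWith_of_compact hK
    refine ⟨C, fun x hx s hs t ht => ?_⟩
    have := hC.dist_le_mul (x, s) ⟨hx, hs⟩ (x, t) ⟨hx, ht⟩
    simpa [dist_eq_norm, Prod.norm_def] using this
  obtain ⟨C₁, h₁⟩ := hlip _ (contDiff_spaceDeriv hG)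
  obtain ⟨C₂, h₂⟩ := hlip _ hG
  refine ⟨C₁ + C₂, by positivity, fun x hx s hs t ht => ?_, fun x hx s hs t ht => ?_,
    fun x hx y hy s hs t ht => ?_⟩
  · refine (h₁ x (hR hx) s hs t ht).trans ?_
    gcongr
    simp
  · refine (h₂ x (hR hx) s hs t ht).trans ?_
    gcongr
    simp
  · have := (convex_closedBall (0 : Amb n) R).norm_image_sub_le_of_norm_hasFDerivWithin_le
      (fun z _ => ((hasFDerivAt_spaceDeriv hG z s).sub
        (hasFDerivAt_spaceDeriv hG z t)).hasFDerivWithinAt)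
      (fun z hz => h₁ z hz s hs t ht) (hR hy) (hR hx)
    refine this.trans ?_
    gcongr
    simp

end Flow

/-! ### Geometry of the moving surface -/

namespace IsMovingHypersurface

variable {n : ℕ} {T : ℝ} {Γ₀ : Set (Amb n)} {Φ : Amb n → ℝ → Amb n} {G : Amb n × ℝ → Amb n}

theorem exists_extension (h : IsMovingHypersurface T Γ₀ Φ) :
    ∃ G : Amb n × ℝ → Amb n, ContDiff ℝ ∞ G ∧ ∀ x ∈ Γ₀, ∀ t ∈ Icc 0 T, Φ x t = G (x, t) := by
  obtain ⟨G, hG, hE⟩ := h.smooth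
  exact ⟨G, hG, fun x hx t ht => hE (x := (x, t)) ⟨hx, ht⟩⟩

theorem exists_inverse (h : IsMovingHypersurface T Γ₀ Φ) {t : ℝ} (ht : t ∈ Icc 0 T) :
    ∃ Ψ : Amb n → Amb n, ContDiff ℝ ∞ Ψ ∧ ∀ x ∈ Γ₀, Ψ (Φ x t) = x := by
  obtain ⟨Ψ, ⟨Ψ', hΨ', hE⟩, hinv⟩ := h.diffeo t ht
  exact ⟨Ψ', hΨ', fun x hx => by rw [← hE ⟨x, hx, rfl⟩, hinv x hx]⟩

theorem injOn (h : IsMovingHypersurface T Γ₀ Φ) {t : ℝ} (ht : t ∈ Icc 0 T) :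
    InjOn (fun x => Φ x t) Γ₀ := by
  obtain ⟨Ψ, -, hinv⟩ := h.exists_inverse ht
  exact LeftInvOn.injOn (f₁' := Ψ) hinv

theorem velocity_eq (h : IsMovingHypersurface T Γ₀ Φ) (hT : 0 < T) (hG : ContDiff ℝ ∞ G)
    (hGΦ : ∀ x ∈ Γ₀, ∀ t ∈ Icc 0 T, Φ x t = G (x, t)) {x : Amb n} (hx : x ∈ Γ₀) {t : ℝ}
    (ht : t ∈ Icc 0 T) : velocity T Γ₀ Φ (Φ x t) t = timeDeriv G (x, t) := by
  have hinv : Function.invFunOn (fun x => Φ x t) Γ₀ (Φ x t) = x :=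
    (h.injOn ht).leftInvOn_invFunOn hx
  rw [velocity, hinv]
  exact ((hasDerivAt_timeDeriv hG x t).hasDerivWithinAt.congr (fun s hs => hGΦ x hx s hs)
    (hGΦ x hx t ht)).derivWithin (uniqueDiffOn_Icc hT t ht)

theorem mapsTo_tangentSpaceAt {X : Set (Amb n)} {g : Amb n → Amb n} {A : Amb n →L[ℝ] Amb n}
    {x v : Amb n} (hg : HasFDerivWithinAt g A X x) (hv : v ∈ tangentSpaceAt X x) :
    A v ∈ tangentSpaceAt (g '' X) (g x) := by
  have := hg.mapsTo_tangent_cone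
  have hle : tangentSpaceAt X x ≤ (tangentSpaceAt (g '' X) (g x)).comap A.toLinearMap :=
    Submodule.span_le.2 fun w hw => Submodule.subset_span (this hw)
  exact hle hv

/-- Derivatives within a hypersurface are not unique on the ambient space; this is the uniqueness
that survives and makes the choice of extensions harmless. -/
theorem eqOn_tangentSpaceAt {X : Set (Amb n)} {g : Amb n → Amb n} {A B : Amb n →L[ℝ] Amb n}
    {x v : Amb n} (hA : HasFDerivWithinAt g A X x) (hB : HasFDerivWithinAt g B X x)
    (hv : v ∈ tangentSpaceAt X x) : A v = B v :=
  LinearMap.eqOn_span (f := A.toLinearMap) (g := B.toLinearMap) (hA.unique_on hB) hv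

section

variable {x : Amb n} {t : ℝ} {Ψ : Amb n → Amb n}

theorem hasFDerivWithinAt (hG : ContDiff ℝ ∞ G)
    (hGΦ : ∀ x ∈ Γ₀, ∀ t ∈ Icc 0 T, Φ x t = G (x, t)) (hx : x ∈ Γ₀) (ht : t ∈ Icc 0 T) :
    HasFDerivWithinAt (fun x => Φ x t) (spaceDeriv G (x, t)) Γ₀ x :=
  (hasFDerivAt_spaceDeriv hG x t).hasFDerivWithinAt.congr (fun z hz => hGΦ z hz t ht)
    (hGΦ x hx t ht)

theorem spaceDeriv_mem (hG : ContDiff ℝ ∞ G)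
    (hGΦ : ∀ x ∈ Γ₀, ∀ t ∈ Icc 0 T, Φ x t = G (x, t)) (hx : x ∈ Γ₀) (ht : t ∈ Icc 0 T)
    {v : Amb n} (hv : v ∈ tangentSpaceAt Γ₀ x) :
    spaceDeriv G (x, t) v ∈ tangentSpaceAt (surf Γ₀ Φ t) (Φ x t) :=
  mapsTo_tangentSpaceAt (hasFDerivWithinAt hG hGΦ hx ht) hv

theorem spaceDeriv_zero_apply (h : IsMovingHypersurface T Γ₀ Φ) (hT : 0 < T)
    (hG : ContDiff ℝ ∞ G) (hGΦ : ∀ x ∈ Γ₀, ∀ t ∈ Icc 0 T, Φ x t = G (x, t)) (hx : x ∈ Γ₀)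
    {v : Amb n} (hv : v ∈ tangentSpaceAt Γ₀ x) : spaceDeriv G (x, 0) v = v := by
  have h1 := hasFDerivWithinAt hG hGΦ hx (left_mem_Icc.2 hT.le)
  have h2 : HasFDerivWithinAt (fun x => Φ x 0) (ContinuousLinearMap.id ℝ (Amb n)) Γ₀ x :=
    (hasFDerivWithinAt_id x Γ₀).congr h.initial (h.initial x hx)
  exact eqOn_tangentSpaceAt h1 h2 hv

theorem fderiv_inverse_mem (hΨ : ContDiff ℝ ∞ Ψ) (hinv : ∀ x ∈ Γ₀, Ψ (Φ x t) = x) (hx : x ∈ Γ₀)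
    {w : Amb n} (hw : w ∈ tangentSpaceAt (surf Γ₀ Φ t) (Φ x t)) :
    fderiv ℝ Ψ (Φ x t) w ∈ tangentSpaceAt Γ₀ x := by
  have hd := ((hΨ.differentiable (by simp)) (Φ x t)).hasFDerivAt.hasFDerivWithinAt
    (s := surf Γ₀ Φ t)
  have := mapsTo_tangentSpaceAt hd hw
  rwa [surf, image_image, image_congr hinv, image_id', hinv x hx] at this

theorem spaceDeriv_fderiv_inverse (hG : ContDiff ℝ ∞ G)
    (hGΦ : ∀ x ∈ Γ₀, ∀ t ∈ Icc 0 T, Φ x t = G (x, t))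
    (hΨ : ContDiff ℝ ∞ Ψ) (hinv : ∀ x ∈ Γ₀, Ψ (Φ x t) = x) (hx : x ∈ Γ₀) (ht : t ∈ Icc 0 T)
    {w : Amb n} (hw : w ∈ tangentSpaceAt (surf Γ₀ Φ t) (Φ x t)) :
    spaceDeriv G (x, t) (fderiv ℝ Ψ (Φ x t) w) = w := by
  have hd := ((hΨ.differentiable (by simp)) (Φ x t)).hasFDerivAt.hasFDerivWithinAt
    (s := surf Γ₀ Φ t)
  have h1 : HasFDerivWithinAt (fun y => G (Ψ y, t))
      (spaceDeriv G (x, t) ∘L fderiv ℝ Ψ (Φ x t)) (surf Γ₀ Φ t) (Φ x t) := by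
    have := hasFDerivAt_spaceDeriv hG x t
    rw [← hinv x hx] at this
    have := this.comp_hasFDerivWithinAt _ hd
    rwa [hinv x hx] at this
  have hid : ∀ y ∈ surf Γ₀ Φ t, y = G (Ψ y, t) := by
    rintro _ ⟨z, hz, rfl⟩
    simp only [hinv z hz]
    exact hGΦ z hz t ht
  have h2 := h1.congr hid (hid _ ⟨x, hx, rfl⟩)
  exact eqOn_tangentSpaceAt h2 (hasFDerivWithinAt_id _ _) hw

end

/-- A linear map which agrees with the spatial derivative of the flow on the tangent space of the
initial surface and with the identity on the normal space. -/
def frame (Γ₀ : Set (Amb n)) (G : Amb n × ℝ → Amb n) (p : Amb n × ℝ) : Amb n →L[ℝ] Amb n :=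
  spaceDeriv G p * tangentProj Γ₀ p.1 + (1 - tangentProj Γ₀ p.1)

theorem tangentProj_apply_mem (S : Set (Amb n)) (x w : Amb n) :
    tangentProj S x w ∈ tangentSpaceAt S x :=
  Submodule.starProjection_apply_mem _ w

theorem tangentProj_apply_of_mem {S : Set (Amb n)} {x w : Amb n} (hw : w ∈ tangentSpaceAt S x) :
    tangentProj S x w = w :=
  Submodule.starProjection_eq_self_iff.2 hw

theorem frame_apply_of_mem {x v : Amb n} {t : ℝ} (hv : v ∈ tangentSpaceAt Γ₀ x) :
    frame Γ₀ G (x, t) v = spaceDeriv G (x, t) v := by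
  simp [frame, tangentProj_apply_of_mem hv]

theorem continuousOn_frame (h : IsMovingHypersurface T Γ₀ Φ) (hG : ContDiff ℝ ∞ G) (δ : ℝ) :
    ContinuousOn (frame Γ₀ G) (Γ₀ ×ˢ Icc 0 δ) := by
  have h1 : ContinuousOn (fun p : Amb n × ℝ => tangentProj Γ₀ p.1) (Γ₀ ×ˢ Icc 0 δ) :=
    h.hypersurface.continuousOn_tangentProj.comp continuousOn_fst fun p hp => hp.1
  exact ((contDiff_spaceDeriv hG).continuous.continuousOn.mul h1).add
    (continuousOn_const.sub h1)

/-- At time zero the flow acts as the identity on tangent vectors, so the frame is there the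
identity. At time `t` it differs from it by an operator of norm at most `C t < 1`, and the Neumann
series applies. -/
theorem isUnit_frame (h : IsMovingHypersurface T Γ₀ Φ) (hT : 0 < T) (hG : ContDiff ℝ ∞ G)
    (hGΦ : ∀ x ∈ Γ₀, ∀ t ∈ Icc 0 T, Φ x t = G (x, t)) {C : ℝ}
    (hC : ∀ x ∈ Γ₀, ∀ s ∈ Icc 0 T, ∀ t ∈ Icc 0 T,
        ‖spaceDeriv G (x, s) - spaceDeriv G (x, t)‖ ≤ C * |s - t|) {x : Amb n} (hx : x ∈ Γ₀)
    {t : ℝ} (ht : t ∈ Icc 0 T) (htC : C * t < 1) : IsUnit (frame Γ₀ G (x, t)) := by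
  have h1 : frame Γ₀ G (x, t) =
      1 - (spaceDeriv G (x, 0) - spaceDeriv G (x, t)) * tangentProj Γ₀ x := by
    have : spaceDeriv G (x, 0) * tangentProj Γ₀ x = tangentProj Γ₀ x := by
      ext1 w
      exact h.spaceDeriv_zero_apply hT hG hGΦ hx (tangentProj_apply_mem _ _ _)
    rw [frame, sub_mul, this]
    abel
  rw [h1]
  refine isUnit_one_sub_of_norm_lt_one ?_
  have h2 := hC x hx 0 (left_mem_Icc.2 hT.le) t ht
  rw [zero_sub, abs_neg, abs_of_nonneg ht.1] at h2
  calc _ ≤ ‖spaceDeriv G (x, 0) - spaceDeriv G (x, t)‖ * ‖tangentProj Γ₀ x‖ := norm_mul_le _ _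
    _ ≤ ‖spaceDeriv G (x, 0) - spaceDeriv G (x, t)‖ * 1 := by
        gcongr
        exact Submodule.starProjection_norm_le _
    _ < 1 := by linarith

section

variable {δ : ℝ}

/-- The inverses `Ψ` are given separately for each time, with no regularity in `t`. On tangent
vectors their derivatives are the inverse frame, which is continuous in space and time. -/
theorem inverse_frame_apply (hG : ContDiff ℝ ∞ G)
    (hGΦ : ∀ x ∈ Γ₀, ∀ t ∈ Icc 0 T, Φ x t = G (x, t)) {x : Amb n} (hx : x ∈ Γ₀) {t : ℝ}
    (ht : t ∈ Icc 0 T) (hu : IsUnit (frame Γ₀ G (x, t))) {Ψ : Amb n → Amb n}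
    (hΨ : ContDiff ℝ ∞ Ψ) (hinv : ∀ x ∈ Γ₀, Ψ (Φ x t) = x) {w : Amb n}
    (hw : w ∈ tangentSpaceAt (surf Γ₀ Φ t) (Φ x t)) :
    Ring.inverse (frame Γ₀ G (x, t)) w = fderiv ℝ Ψ (Φ x t) w := by
  have hv := fderiv_inverse_mem hΨ hinv hx hw
  have h1 : frame Γ₀ G (x, t) (fderiv ℝ Ψ (Φ x t) w) = w := by
    rw [frame_apply_of_mem hv, spaceDeriv_fderiv_inverse hG hGΦ hΨ hinv hx ht hw]
  have h2 := Ring.inverse_mul_cancel _ hu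
  have h3 := DFunLike.congr_fun h2 (fderiv ℝ Ψ (Φ x t) w)
  rw [mul_apply_eq_comp, h1] at h3
  exact h3

theorem continuousOn_inverse_frame (h : IsMovingHypersurface T Γ₀ Φ) (hG : ContDiff ℝ ∞ G)
    (hu : ∀ p ∈ Γ₀ ×ˢ Icc 0 δ, IsUnit (frame Γ₀ G p)) :
    ContinuousOn (fun p => Ring.inverse (frame Γ₀ G p)) (Γ₀ ×ˢ Icc 0 δ) := by
  intro p hp
  have h2 := NormedRing.inverse_continuousAt (hu p hp).unit
  rw [(hu p hp).unit_spec] at h2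
  exact h2.comp_continuousWithinAt (h.continuousOn_frame hG δ p hp)

theorem continuousOn_tangentProj (h : IsMovingHypersurface T Γ₀ Φ) (hG : ContDiff ℝ ∞ G)
    (hGΦ : ∀ x ∈ Γ₀, ∀ t ∈ Icc 0 T, Φ x t = G (x, t)) (hδT : δ ≤ T)
    (hu : ∀ p ∈ Γ₀ ×ˢ Icc 0 δ, IsUnit (frame Γ₀ G p)) :
    ContinuousOn (fun p : Amb n × ℝ => tangentProj (surf Γ₀ Φ p.2) (Φ p.1 p.2))
      (Γ₀ ×ˢ Icc 0 δ) := by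
  have hP : ContinuousOn (fun p : Amb n × ℝ => tangentProj Γ₀ p.1) (Γ₀ ×ˢ Icc 0 δ) :=
    h.hypersurface.continuousOn_tangentProj.comp continuousOn_fst fun p hp => hp.1
  refine ContinuousOn.starProjection_of_idempotent
    -- Conjugating the initial projection by the frame gives an oblique projection onto the tangent
    -- space of `Γ(t)`, already known to be continuous.
    (Q := fun p => frame Γ₀ G p * tangentProj Γ₀ p.1 * Ring.inverse (frame Γ₀ G p))
    (((h.continuousOn_frame hG δ).mul hP).mul (h.continuousOn_inverse_frame hG hu)) ?_ ?_
  · rintro ⟨x, t⟩ ⟨hx, ht⟩ w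
    simp only [mul_apply_eq_comp]
    have hm := tangentProj_apply_mem Γ₀ x (Ring.inverse (frame Γ₀ G (x, t)) w)
    rw [frame_apply_of_mem hm]
    exact spaceDeriv_mem hG hGΦ hx ⟨ht.1, ht.2.trans hδT⟩ hm
  · rintro ⟨x, t⟩ ⟨hx, ht⟩ w hw
    have ht' : t ∈ Icc 0 T := ⟨ht.1, ht.2.trans hδT⟩
    obtain ⟨Ψ, hΨ, hinv⟩ := h.exists_inverse ht'
    have hv := fderiv_inverse_mem hΨ hinv hx hw
    simp only [mul_apply_eq_comp]
    rw [inverse_frame_apply hG hGΦ hx ht' (hu _ ⟨hx, ht⟩) hΨ hinv hw,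
      tangentProj_apply_of_mem hv, frame_apply_of_mem hv,
      spaceDeriv_fderiv_inverse hG hGΦ hΨ hinv hx ht' hw]

theorem tangentialDiv_velocity_eq (h : IsMovingHypersurface T Γ₀ Φ) (hT : 0 < T)
    (hG : ContDiff ℝ ∞ G) (hGΦ : ∀ x ∈ Γ₀, ∀ t ∈ Icc 0 T, Φ x t = G (x, t)) {x : Amb n}
    (hx : x ∈ Γ₀) {t : ℝ} (ht : t ∈ Icc 0 T) (hu : IsUnit (frame Γ₀ G (x, t))) :
    tangentialDiv (surf Γ₀ Φ t) (fun z => velocity T Γ₀ Φ z t) (Φ x t) =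
      LinearMap.trace ℝ (Amb n) (tangentProj (surf Γ₀ Φ t) (Φ x t) *
        (spaceDeriv (timeDeriv G) (x, t) * Ring.inverse (frame Γ₀ G (x, t))) *
        tangentProj (surf Γ₀ Φ t) (Φ x t) : Amb n →L[ℝ] Amb n).toLinearMap := by
  obtain ⟨Ψ, hΨ, hinv⟩ := h.exists_inverse ht
  have hd := ((hΨ.differentiable (by simp)) (Φ x t)).hasFDerivAt.hasFDerivWithinAt
    (s := surf Γ₀ Φ t)
  have h1 : HasFDerivWithinAt (fun z => velocity T Γ₀ Φ z t)
      (spaceDeriv (timeDeriv G) (x, t) ∘L fderiv ℝ Ψ (Φ x t)) (surf Γ₀ Φ t) (Φ x t) := by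
    have := hasFDerivAt_spaceDeriv (contDiff_timeDeriv hG) x t
    rw [← hinv x hx] at this
    have := this.comp_hasFDerivWithinAt _ hd
    rw [hinv x hx] at this
    have hE : ∀ y ∈ surf Γ₀ Φ t, velocity T Γ₀ Φ y t = timeDeriv G (Ψ y, t) := by
      rintro _ ⟨z, hz, rfl⟩
      rw [hinv z hz]
      exact h.velocity_eq hT hG hGΦ hz ht
    exact this.congr hE (hE _ ⟨x, hx, rfl⟩)
  have h2 := h1.differentiableWithinAt.hasFDerivWithinAt
  unfold tangentialDiv
  congr 2
  ext1 w
  have hw := tangentProj_apply_mem (surf Γ₀ Φ t) (Φ x t) w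
  simp only [ContinuousLinearMap.comp_apply, mul_apply_eq_comp]
  rw [eqOn_tangentSpaceAt h2 h1 hw, inverse_frame_apply hG hGΦ hx ht hu hΨ hinv hw]
  rfl

theorem continuousOn_tangentialDiv_velocity (h : IsMovingHypersurface T Γ₀ Φ) (hT : 0 < T)
    (hG : ContDiff ℝ ∞ G) (hGΦ : ∀ x ∈ Γ₀, ∀ t ∈ Icc 0 T, Φ x t = G (x, t)) (hδT : δ ≤ T)
    (hu : ∀ p ∈ Γ₀ ×ˢ Icc 0 δ, IsUnit (frame Γ₀ G p)) :
    ContinuousOn (fun p : Amb n × ℝ => tangentialDiv (surf Γ₀ Φ p.2)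
      (fun z => velocity T Γ₀ Φ z p.2) (Φ p.1 p.2)) (Γ₀ ×ˢ Icc 0 δ) := by
  have hP := h.continuousOn_tangentProj hG hGΦ hδT hu
  have hM : ContinuousOn (fun p : Amb n × ℝ => tangentProj (surf Γ₀ Φ p.2) (Φ p.1 p.2) *
        (spaceDeriv (timeDeriv G) p * Ring.inverse (frame Γ₀ G p)) *
        tangentProj (surf Γ₀ Φ p.2) (Φ p.1 p.2)) (Γ₀ ×ˢ Icc 0 δ) :=
    (hP.mul ((contDiff_spaceDeriv (contDiff_timeDeriv hG)).continuous.continuousOn.mul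
      (h.continuousOn_inverse_frame hG hu))).mul hP
  have htr : Continuous fun M : Amb n →L[ℝ] Amb n => LinearMap.trace ℝ (Amb n) M.toLinearMap :=
    LinearMap.continuous_of_finiteDimensional
      (LinearMap.trace ℝ (Amb n) ∘ₗ ContinuousLinearMap.coeLM ℝ)
  refine (htr.comp_continuousOn hM).congr ?_
  rintro ⟨x, t⟩ ⟨hx, ht⟩
  exact h.tangentialDiv_velocity_eq hT hG hGΦ hx ⟨ht.1, ht.2.trans hδT⟩ (hu _ ⟨hx, ht⟩)

end

end IsMovingHypersurface

/-! ### The surface measures, pulled back to the initial surface -/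

namespace IsMovingHypersurface

variable {n : ℕ} {T : ℝ} {Γ₀ : Set (Amb n)} {Φ : Amb n → ℝ → Amb n} {G : Amb n × ℝ → Amb n}

/-- As `C δ ≤ 1/2`, the flow shrinks distances by at most the factor 2 up to time `δ`. The increment
from `t` to `s` has Lipschitz constant `C |s - t|` on `Γ₀`, hence at most `2 C |s - t|` when
measured on `Γ(t)`. -/
theorem surfMeas_image_le (h : IsMovingHypersurface T Γ₀ Φ) (hT : 0 < T)
    (hGΦ : ∀ x ∈ Γ₀, ∀ t ∈ Icc 0 T, Φ x t = G (x, t)) {C δ : ℝ} (hC0 : 0 ≤ C)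
    (hC : ∀ x ∈ Γ₀, ∀ y ∈ Γ₀, ∀ s ∈ Icc 0 T, ∀ t ∈ Icc 0 T,
        ‖(G (x, s) - G (x, t)) - (G (y, s) - G (y, t))‖ ≤ C * |s - t| * ‖x - y‖)
    (hδT : δ ≤ T) (hδ : C * δ ≤ 1 / 2) {s t : ℝ} (hs : s ∈ Icc 0 δ) (ht : t ∈ Icc 0 δ)
    (A : Set (Amb n)) :
    surfMeas n ((fun x => Φ x s) '' (A ∩ Γ₀)) ≤
      ENNReal.ofReal (1 + 2 * C * |s - t|) ^ n * surfMeas n ((fun x => Φ x t) '' (A ∩ Γ₀)) := by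
  refine euclideanHausdorffMeasure_image_le_image
    (K := Real.toNNReal (1 + 2 * C * |s - t|)) (fun a ha b hb => ?_) n
  have h0 : (0 : ℝ) ∈ Icc 0 T := left_mem_Icc.2 hT.le
  have hs' : s ∈ Icc 0 T := ⟨hs.1, hs.2.trans hδT⟩
  have ht' : t ∈ Icc 0 T := ⟨ht.1, ht.2.trans hδT⟩
  have h1 := hC a ha.2 b hb.2 s hs' t ht'
  have h2 := hC a ha.2 b hb.2 t ht' 0 h0
  rw [← hGΦ a ha.2 s hs', ← hGΦ a ha.2 t ht', ← hGΦ b hb.2 s hs', ← hGΦ b hb.2 t ht'] at h1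
  rw [← hGΦ a ha.2 0 h0, ← hGΦ a ha.2 t ht', ← hGΦ b hb.2 0 h0, ← hGΦ b hb.2 t ht',
    h.initial a ha.2, h.initial b hb.2, sub_zero, abs_of_nonneg ht.1] at h2
  simp only [dist_eq_norm]
  rw [Real.coe_toNNReal _ (by positivity)]
  have h3 : ‖a - b‖ ≤ 2 * ‖Φ a t - Φ b t‖ := by
    have h4 : ‖a - b‖ ≤ ‖Φ a t - Φ b t‖ + ‖(Φ a t - a) - (Φ b t - b)‖ := by
      have : a - b = (Φ a t - Φ b t) - ((Φ a t - a) - (Φ b t - b)) := by abel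
      nth_rewrite 1 [this]
      exact norm_sub_le _ _
    have h5 : C * t * ‖a - b‖ ≤ 1 / 2 * ‖a - b‖ := by
      gcongr
      exact (mul_le_mul_of_nonneg_left ht.2 hC0).trans hδ
    linarith
  calc ‖Φ a s - Φ b s‖ = ‖(Φ a t - Φ b t) + ((Φ a s - Φ a t) - (Φ b s - Φ b t))‖ := by
        congr 1; abel
    _ ≤ ‖Φ a t - Φ b t‖ + C * |s - t| * ‖a - b‖ := (norm_add_le _ _).trans (by gcongr)
    _ ≤ ‖Φ a t - Φ b t‖ + C * |s - t| * (2 * ‖Φ a t - Φ b t‖) := by gcongr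
    _ = _ := by ring

theorem isCompact_surf (h : IsMovingHypersurface T Γ₀ Φ) {t : ℝ} (ht : t ∈ Icc 0 T) :
    IsCompact (surf Γ₀ Φ t) := by
  obtain ⟨G, hG, hGΦ⟩ := h.exists_extension
  refine h.hypersurface.1.image_of_continuousOn ?_
  have : Continuous fun x => G (x, t) := hG.continuous.comp (by fun_prop)
  exact this.continuousOn.congr fun x hx => hGΦ x hx t ht

/-- The measure is the push-forward of surface measure on `Γ(t)` under a smooth extension of the
inverse flow map. -/
theorem exists_pulledMeasure (h : IsMovingHypersurface T Γ₀ Φ) {t : ℝ} (ht : t ∈ Icc 0 T) :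
    ∃ m : Measure (Amb n),
      (∀ A, MeasurableSet A → m A = surfMeas n ((fun x => Φ x t) '' (A ∩ Γ₀))) ∧
      ∀ g : Amb n → ℝ, AEStronglyMeasurable (fun x => g (Φ x t)) m →
        ∫ y in surf Γ₀ Φ t, g y ∂(surfMeas n) = ∫ x, g (Φ x t) ∂m := by
  obtain ⟨Ψ, hΨ, hinv⟩ := h.exists_inverse ht
  have hm : MeasurableSet (surf Γ₀ Φ t) := (h.isCompact_surf ht).measurableSet
  refine ⟨Measure.map Ψ ((surfMeas n).restrict (surf Γ₀ Φ t)), fun A hA => ?_, fun g hg => ?_⟩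
  · rw [Measure.map_apply hΨ.continuous.measurable hA,
      Measure.restrict_apply (hΨ.continuous.measurable hA)]
    congr 1
    ext y
    constructor
    · rintro ⟨hy, x, hx, rfl⟩
      refine ⟨x, ⟨?_, hx⟩, rfl⟩
      have : Ψ (Φ x t) ∈ A := hy
      rwa [hinv x hx] at this
    · rintro ⟨x, ⟨hxA, hx⟩, rfl⟩
      refine ⟨?_, x, hx, rfl⟩
      change Ψ (Φ x t) ∈ A
      rwa [hinv x hx]
  · rw [integral_map hΨ.continuous.aemeasurable hg]
    refine setIntegral_congr_fun hm ?_
    rintro _ ⟨x, hx, rfl⟩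
    simp only [hinv x hx]

theorem exists_kernel (h : IsMovingHypersurface T Γ₀ Φ) (hT : 0 < T)
    (hGΦ : ∀ x ∈ Γ₀, ∀ t ∈ Icc 0 T, Φ x t = G (x, t)) {C δ : ℝ} (hC0 : 0 ≤ C)
    (hC : ∀ x ∈ Γ₀, ∀ y ∈ Γ₀, ∀ s ∈ Icc 0 T, ∀ t ∈ Icc 0 T,
        ‖(G (x, s) - G (x, t)) - (G (y, s) - G (y, t))‖ ≤ C * |s - t| * ‖x - y‖)
    (hδ0 : 0 ≤ δ) (hδT : δ ≤ T) (hδ : C * δ ≤ 1 / 2) :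
    ∃ κ : Kernel ℝ (Amb n), IsFiniteKernel κ ∧
      ∀ t ∈ Icc 0 δ,
        κ t ≤ ENNReal.ofReal (1 + 2 * C * t) ^ n • (surfMeas n).restrict Γ₀ ∧
        (surfMeas n).restrict Γ₀ ≤ ENNReal.ofReal (1 + 2 * C * t) ^ n • κ t ∧
        ∀ g : Amb n → ℝ, AEStronglyMeasurable (fun x => g (Φ x t)) (κ t) →
          ∫ y in surf Γ₀ Φ t, g y ∂(surfMeas n) = ∫ x, g (Φ x t) ∂(κ t) := by
  classical
  have hsub : ∀ t ∈ Icc 0 δ, t ∈ Icc 0 T := fun t ht => ⟨ht.1, ht.2.trans hδT⟩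
  have h0 : (0 : ℝ) ∈ Icc 0 δ := left_mem_Icc.2 hδ0
  choose! m hm hmint using fun t (ht : t ∈ Icc 0 T) => h.exists_pulledMeasure ht
  have hle := fun s (hs : s ∈ Icc 0 δ) t (ht : t ∈ Icc 0 δ) A =>
    h.surfMeas_image_le hT hGΦ hC0 hC hδT hδ hs ht A
  have himg0 : ∀ A, (fun x => Φ x 0) '' (A ∩ Γ₀) = A ∩ Γ₀ := fun A => by
    rw [image_congr (g := id) fun x hx => h.initial x hx.2, image_id]
  have hfin : ∀ t ∈ Icc 0 δ, ∀ A, surfMeas n ((fun x => Φ x t) '' (A ∩ Γ₀)) ≤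
      ENNReal.ofReal (1 + 2 * C * δ) ^ n * surfMeas n Γ₀ := by
    intro t ht A
    refine (hle t ht 0 h0 A).trans ?_
    rw [himg0, sub_zero, abs_of_nonneg ht.1]
    gcongr
    · exact ht.2
    · exact inter_subset_right
  have hbound : ENNReal.ofReal (1 + 2 * C * δ) ^ n * surfMeas n Γ₀ < ⊤ :=
    ENNReal.mul_lt_top (by finiteness) h.hypersurface.surfMeas_lt_top
  -- The two-sided comparison between times `s` and `t` squeezes the area of the transported set as
  -- `s → t`. This continuity supplies the measurability in time that a kernel requires.
  have hcont : ∀ A, ContinuousOn (fun t => surfMeas n ((fun x => Φ x t) '' (A ∩ Γ₀)))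
      (Icc 0 δ) := by
    intro A t ht
    set L : ℝ → ℝ≥0∞ := fun s => ENNReal.ofReal (1 + 2 * C * |s - t|) ^ n
    have hL : Tendsto L (𝓝[Icc 0 δ] t) (𝓝 1) := by
      have h1 : Tendsto (fun s => 1 + 2 * C * |s - t|) (𝓝[Icc 0 δ] t) (𝓝 (1 + 2 * C * |t - t|)) :=
        (by fun_prop : Continuous fun s => 1 + 2 * C * |s - t|).continuousAt.continuousWithinAt
      have h2 := ((ENNReal.continuous_pow n).tendsto _).comp (ENNReal.tendsto_ofReal h1)
      simp only [sub_self, abs_zero, mul_zero, add_zero, ENNReal.ofReal_one, one_pow] at h2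
      exact h2
    have hne : surfMeas n ((fun x => Φ x t) '' (A ∩ Γ₀)) ≠ ⊤ :=
      ((hfin t ht A).trans_lt hbound).ne
    have hup := ENNReal.Tendsto.mul_const hL (Or.inr hne)
    have hlow := ENNReal.Tendsto.mul_const (tendsto_inv_iff.2 hL) (Or.inr hne)
    rw [one_mul] at hup
    rw [inv_one, one_mul] at hlow
    refine tendsto_of_tendsto_of_tendsto_of_le_of_le' hlow hup ?_ ?_
    · filter_upwards [self_mem_nhdsWithin] with s hs
      have h1 := hle t ht s hs A
      rw [abs_sub_comm] at h1
      have hL0 : L s ≠ 0 := by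
        refine pow_ne_zero _ (ENNReal.ofReal_pos.2 ?_).ne'
        positivity
      rw [ENNReal.inv_mul_le_iff hL0 (by finiteness)]
      exact h1
    · filter_upwards [self_mem_nhdsWithin] with s hs using hle s hs t ht A
  have hmeas : Measurable fun t => if t ∈ Icc 0 δ then m t else 0 := by
    refine Measure.measurable_of_measurable_coe _ fun A hA => ?_
    have hE : (fun t => (if t ∈ Icc 0 δ then m t else 0) A) =
        (Icc 0 δ).piecewise (fun t => surfMeas n ((fun x => Φ x t) '' (A ∩ Γ₀)))
          (fun _ => 0) := by
      ext t
      by_cases ht : t ∈ Icc 0 δ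
      · simp only [ht, if_true, piecewise_eq_of_mem, hm t (hsub t ht) A hA]
      · simp only [ht, if_false, piecewise_eq_of_notMem, not_false_eq_true, Measure.coe_zero,
          Pi.zero_apply]
    rw [hE]
    exact (hcont A).measurable_piecewise continuousOn_const measurableSet_Icc
  refine ⟨⟨_, hmeas⟩, ⟨⟨_, hbound, fun t => ?_⟩⟩, fun t ht => ?_⟩
  · change (if t ∈ Icc 0 δ then m t else 0) univ ≤ _
    split_ifs with ht
    · rw [hm t (hsub t ht) univ .univ]
      exact hfin t ht univ
    · simp
  · have hκ : (⟨_, hmeas⟩ : Kernel ℝ (Amb n)) t = m t := by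
      change (if t ∈ Icc 0 δ then m t else 0) = _
      rw [if_pos ht]
    rw [hκ]
    refine ⟨Measure.le_iff.2 fun A hA => ?_, Measure.le_iff.2 fun A hA => ?_,
      hmint t (hsub t ht)⟩
    · have := hle t ht 0 h0 A
      rw [himg0, sub_zero, abs_of_nonneg ht.1] at this
      rw [hm t (hsub t ht) A hA, Measure.smul_apply, Measure.restrict_apply hA]
      exact this
    · have := hle 0 h0 t ht A
      rw [himg0, zero_sub, abs_neg, abs_of_nonneg ht.1] at this
      rw [Measure.smul_apply, hm t (hsub t ht) A hA, Measure.restrict_apply hA]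
      exact this

end IsMovingHypersurface

/-! ### Measure-theoretic preliminaries -/

theorem ContinuousOn.aestronglyMeasurable_comp {α β γ : Type*} [MeasurableSpace α]
    [TopologicalSpace β] [MeasurableSpace β] [OpensMeasurableSpace β] [TopologicalSpace γ]
    [TopologicalSpace.PseudoMetrizableSpace γ] [SecondCountableTopologyEither β γ]
    {f : β → γ} {s : Set β} (hf : ContinuousOn f s)
    (hs : MeasurableSet s) {g : α → β} {μ : Measure α} (hg : AEMeasurable g μ)
    (hgs : ∀ᵐ a ∂μ, g a ∈ s) : AEStronglyMeasurable (fun a => f (g a)) μ := by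
  have h1 : AEStronglyMeasurable f (Measure.map g μ) := by
    rw [← Measure.restrict_eq_self_of_ae_mem ((ae_map_iff hg hs).2 hgs)]
    exact hf.aestronglyMeasurable hs
  exact h1.comp_aemeasurable hg

/-! ### Null sets, measurability and bounds for measures depending on time. -/

section Kernel

variable {X Y : Type*} [MeasurableSpace X] [MeasurableSpace Y] {μ : Measure X} {ν : Measure Y}
  [SFinite μ] [SFinite ν] {κ : Kernel Y X}

theorem ae_ae_kernel_of_ae_prod (hκ : ∀ᵐ y ∂ν, κ y ≪ μ) {p : X × Y → Prop}
    (hp : ∀ᵐ z ∂(μ.prod ν), p z) : ∀ᵐ y ∂ν, ∀ᵐ x ∂(κ y), p (x, y) := by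
  have h1 : ∀ᵐ z ∂(ν.prod μ), p z.swap := by
    rw [← Measure.prod_swap] at hp
    exact ae_of_ae_map measurable_swap.aemeasurable hp
  filter_upwards [Measure.ae_ae_of_ae_prod h1, hκ] with y hy hκy using hκy.ae_le hy

theorem ae_aestronglyMeasurable_kernel (hκ : ∀ᵐ y ∂ν, κ y ≪ μ) {f : X × Y → ℝ}
    (hf : AEStronglyMeasurable f (μ.prod ν)) :
    ∀ᵐ y ∂ν, AEStronglyMeasurable (fun x => f (x, y)) (κ y) := by
  filter_upwards [ae_ae_kernel_of_ae_prod hκ hf.ae_eq_mk] with y hy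
  exact ⟨fun x => hf.mk f (x, y),
    hf.stronglyMeasurable_mk.comp_measurable measurable_prodMk_right, hy⟩

theorem aestronglyMeasurable_integral_kernel [IsSFiniteKernel κ] (hκ : ∀ᵐ y ∂ν, κ y ≪ μ)
    {f : X × Y → ℝ} (hf : AEStronglyMeasurable f (μ.prod ν)) :
    AEStronglyMeasurable (fun y => ∫ x, f (x, y) ∂(κ y)) ν := by
  refine ⟨fun y => ∫ x, hf.mk f (x, y) ∂(κ y),
    hf.stronglyMeasurable_mk.integral_kernel_prod_left', ?_⟩
  filter_upwards [ae_ae_kernel_of_ae_prod hκ hf.ae_eq_mk] with y hy using integral_congr_ae hy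

theorem ae_norm_integral_kernel_le [IsFiniteKernel κ] (hκ : ∀ᵐ y ∂ν, κ y ≪ μ) {f : X × Y → ℝ}
    {C : ℝ} (hC0 : 0 ≤ C) (hC : ∀ᵐ z ∂(μ.prod ν), ‖f z‖ ≤ C) :
    ∀ᵐ y ∂ν, ‖∫ x, f (x, y) ∂(κ y)‖ ≤ C * κ.bound.toReal := by
  filter_upwards [ae_ae_kernel_of_ae_prod hκ hC] with y hy
  refine (norm_integral_le_of_norm_le_const hy).trans ?_
  gcongr
  exact ENNReal.toReal_mono κ.bound_ne_top (κ.measure_le_bound y univ)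

end Kernel

/-- Indicators of measurable sets are `L¹` limits of continuous nonnegative functions, and `g` is
bounded, so the hypothesis passes to integrals of `g` over measurable sets. -/
theorem ae_le_zero_of_forall_integral_mul_le {ν : Measure ℝ} [IsFiniteMeasure ν] {g : ℝ → ℝ}
    (hg : AEStronglyMeasurable g ν) {C : ℝ} (hC : ∀ᵐ t ∂ν, ‖g t‖ ≤ C)
    (h : ∀ ρ : ℝ → ℝ, Continuous ρ → (∀ t, 0 ≤ ρ t) → Integrable ρ ν → ∫ t, ρ t * g t ∂ν ≤ 0) :
    g ≤ᵐ[ν] 0 := by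
  have hgi : Integrable g ν := ⟨hg, HasFiniteIntegral.of_bounded hC⟩
  refine ae_le_of_forall_setIntegral_le hgi (integrable_zero _ _ _) fun A hA _ => ?_
  simp only [Pi.zero_apply, integral_zero]
  refine le_of_forall_pos_le_add fun ε hε => ?_
  set D := |C| + 1
  have hD : 0 < D := by positivity
  set χ : ℝ → ℝ := A.indicator 1
  have hχ : Integrable χ ν := (integrable_const (1 : ℝ)).indicator hA
  obtain ⟨ρ, hρ, hρi⟩ := hχ.exists_boundedContinuous_integral_sub_le (div_pos hε hD)
  -- Taking absolute values makes the approximation admissible without increasing its distance to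
  -- the nonnegative `χ`.
  set ρ' : ℝ → ℝ := fun t => |ρ t|
  have hρ'c : Continuous ρ' := ρ.continuous.abs
  have hρ'i : Integrable ρ' ν := hρi.abs
  have hgC : ∀ᵐ t ∂ν, ‖g t‖ ≤ D := by
    filter_upwards [hC] with t ht
    have := le_abs_self C
    linarith
  have h1 := h ρ' hρ'c (fun t => abs_nonneg _) hρ'i
  have h2 : Integrable (fun t => ρ' t * g t) ν := hρ'i.mul_bdd hg hgC
  have h3 : Integrable (fun t => χ t * g t) ν := hχ.mul_bdd hg hgC
  have h4 : ∫ t in A, g t ∂ν = ∫ t, χ t * g t ∂ν := by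
    rw [← integral_indicator hA]
    congr 1
    ext t
    by_cases ht : t ∈ A <;> simp [χ, ht]
  have h5 : ∫ t, χ t * g t ∂ν - ∫ t, ρ' t * g t ∂ν ≤ ∫ t, ‖χ t - ρ t‖ * D ∂ν := by
    rw [← integral_sub h3 h2]
    refine integral_mono_ae (h3.sub h2) ((hχ.sub hρi).norm.mul_const D) ?_
    filter_upwards [hgC] with t ht
    have hχt : 0 ≤ χ t := by
      simp only [χ]
      exact indicator_nonneg (fun _ _ => zero_le_one) t
    calc χ t * g t - ρ' t * g t = (χ t - ρ' t) * g t := by ring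
      _ ≤ ‖(χ t - ρ' t) * g t‖ := le_abs_self _
      _ = ‖χ t - ρ' t‖ * ‖g t‖ := norm_mul _ _
      _ ≤ ‖χ t - ρ t‖ * D := by
          gcongr
          have := abs_abs_sub_abs_le_abs_sub (χ t) (ρ t)
          rwa [abs_of_nonneg hχt] at this
  rw [integral_mul_const] at h5
  have h6 : (∫ t, ‖χ t - ρ t‖ ∂ν) * D ≤ ε := by
    calc _ ≤ ε / D * D := by gcongr
      _ = ε := by field_simp
  linarith

/-! ### Short-time description of the moving surface -/

/-- Short-time data for a moving hypersurface: a smooth extension of the flow, and the surface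
measures pulled back to the initial surface. -/
structure ShortTimeFlow {n : ℕ} (T : ℝ) (Γ₀ : Set (Amb n)) (Φ : Amb n → ℝ → Amb n) where
  δ : ℝ
  C : ℝ
  G : Amb n × ℝ → Amb n
  κ : Kernel ℝ (Amb n)
  δ_pos : 0 < δ
  δ_le : δ ≤ T
  C_nonneg : 0 ≤ C
  contDiff : ContDiff ℝ ∞ G
  eq_G : ∀ x ∈ Γ₀, ∀ t ∈ Icc 0 T, Φ x t = G (x, t)
  dist_le : ∀ x ∈ Γ₀, ∀ t ∈ Icc 0 T, ‖Φ x t - x‖ ≤ C * t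
  finite : IsFiniteKernel κ
  kernel_le : ∀ t ∈ Icc 0 δ, κ t ≤ ENNReal.ofReal (1 + C * t) ^ n • (surfMeas n).restrict Γ₀
  le_kernel : ∀ t ∈ Icc 0 δ, (surfMeas n).restrict Γ₀ ≤ ENNReal.ofReal (1 + C * t) ^ n • κ t
  integral_eq : ∀ t ∈ Icc 0 δ, ∀ g : Amb n → ℝ, AEStronglyMeasurable (fun x => g (Φ x t)) (κ t) →
    ∫ y in surf Γ₀ Φ t, g y ∂(surfMeas n) = ∫ x, g (Φ x t) ∂(κ t)
  continuousOn_proj : ContinuousOn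
    (fun p : Amb n × ℝ => tangentProj (surf Γ₀ Φ p.2) (Φ p.1 p.2)) (Γ₀ ×ˢ Icc 0 δ)
  continuousOn_div : ContinuousOn (fun p : Amb n × ℝ => tangentialDiv (surf Γ₀ Φ p.2)
      (fun z => velocity T Γ₀ Φ z p.2) (Φ p.1 p.2)) (Γ₀ ×ˢ Icc 0 δ)

theorem IsMovingHypersurface.nonempty_shortTimeFlow {n : ℕ} {T : ℝ} {Γ₀ : Set (Amb n)}
    {Φ : Amb n → ℝ → Amb n} (h : IsMovingHypersurface T Γ₀ Φ) (hT : 0 < T) :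
    Nonempty (ShortTimeFlow T Γ₀ Φ) := by
  obtain ⟨G, hG, hGΦ⟩ := h.exists_extension
  obtain ⟨C, hC0, hC1, hC2, hC3⟩ := exists_lipschitz_increment hG h.hypersurface.1 T
  -- This gives `C δ ≤ 1/2`, as needed for the area comparison, and hence also `C t < 1`, as needed
  -- for the frame; the summand 1 covers `C = 0`.
  set δ := min T (1 / (2 * (C + 1)))
  have hδ : 0 < δ := lt_min hT (by positivity)
  have hδT : δ ≤ T := min_le_left _ _
  have hCδ : C * δ ≤ 1 / 2 := by
    calc C * δ ≤ C * (1 / (2 * (C + 1))) := by gcongr; exact min_le_right _ _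
      _ ≤ 1 / 2 := by
        rw [mul_one_div, div_le_div_iff₀ (by positivity) (by norm_num)]
        linarith
  have h0 : (0 : ℝ) ∈ Icc 0 T := left_mem_Icc.2 hT.le
  obtain ⟨κ, hfin, hκ⟩ := h.exists_kernel hT hGΦ hC0 hC3 hδ.le hδT hCδ
  have hu : ∀ p ∈ Γ₀ ×ˢ Icc 0 δ, IsUnit (IsMovingHypersurface.frame Γ₀ G p) := by
    rintro ⟨x, t⟩ ⟨hx, ht⟩
    refine h.isUnit_frame hT hG hGΦ hC1 hx ⟨ht.1, ht.2.trans hδT⟩ ?_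
    have : C * t ≤ C * δ := by gcongr; exact ht.2
    linarith
  exact ⟨{
    δ := δ
    C := 2 * C
    G := G
    κ := κ
    δ_pos := hδ
    δ_le := hδT
    C_nonneg := by positivity
    contDiff := hG
    eq_G := hGΦ
    dist_le := fun x hx t ht => by
      have := hC2 x hx t ht 0 h0
      rw [← hGΦ x hx t ht, ← hGΦ x hx 0 h0, h.initial x hx, sub_zero, abs_of_nonneg ht.1] at this
      have h2 : 0 ≤ C * t := mul_nonneg hC0 ht.1
      linarith
    finite := hfin
    kernel_le := fun t ht => (hκ t ht).1
    le_kernel := fun t ht => (hκ t ht).2.1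
    integral_eq := fun t ht => (hκ t ht).2.2
    continuousOn_proj := h.continuousOn_tangentProj hG hGΦ hδT hu
    continuousOn_div := h.continuousOn_tangentialDiv_velocity hT hG hGΦ hδT hu }⟩

/-! ### Cut-off functions in time -/

section TimeCutoff

variable {r : ℝ → ℝ} {δ : ℝ}

/-- The primitive of `-r` vanishing at `δ`. -/
def timeCutoff (r : ℝ → ℝ) (δ t : ℝ) : ℝ := ∫ s in t..δ, r s

theorem hasDerivAt_timeCutoff (hr : Continuous r) (δ t : ℝ) :
    HasDerivAt (timeCutoff r δ) (-r t) t :=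
  intervalIntegral.integral_hasDerivAt_left (hr.intervalIntegrable _ _)
    (hr.stronglyMeasurableAtFilter _ _) hr.continuousAt

theorem continuous_timeCutoff (hr : Continuous r) (δ : ℝ) : Continuous (timeCutoff r δ) :=
  continuous_iff_continuousAt.2 fun t => (hasDerivAt_timeCutoff hr δ t).continuousAt

theorem contDiff_timeCutoff (hr : Continuous r) (δ : ℝ) : ContDiff ℝ 1 (timeCutoff r δ) := by
  rw [contDiff_one_iff_deriv]
  refine ⟨fun t => (hasDerivAt_timeCutoff hr δ t).differentiableAt, ?_⟩
  rw [show deriv (timeCutoff r δ) = fun t => -r t from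
    funext fun t => (hasDerivAt_timeCutoff hr δ t).deriv]
  exact hr.neg

theorem timeCutoff_eq_zero (hδ : ∀ s, δ ≤ s → r s = 0) {t : ℝ} (ht : δ ≤ t) :
    timeCutoff r δ t = 0 := by
  rw [timeCutoff, intervalIntegral.integral_symm, neg_eq_zero]
  refine (intervalIntegral.integral_congr (g := fun _ => (0 : ℝ)) fun s hs => ?_).trans (by simp)
  rw [uIcc_of_le ht] at hs
  exact hδ s hs.1

theorem timeCutoff_nonneg (hδ : ∀ s, δ ≤ s → r s = 0) (h0 : ∀ s, 0 ≤ r s) (t : ℝ) :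
    0 ≤ timeCutoff r δ t := by
  rcases le_total t δ with h | h
  · exact intervalIntegral.integral_nonneg h fun s _ => h0 s
  · exact (timeCutoff_eq_zero hδ h).ge

/-- Integration by parts; the boundary term `t ζ(t)` vanishes at both ends. An error bounded by a
multiple of `ζ` thereby becomes an error of size `t` against the weight `r`. -/
theorem setIntegral_timeCutoff (hr : Continuous r) (hδ0 : 0 < δ) :
    ∫ t in Ioo 0 δ, timeCutoff r δ t = ∫ t in Ioo 0 δ, t * r t := by
  have hd : ∀ t ∈ uIcc 0 δ, HasDerivAt (fun t => t * timeCutoff r δ t)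
      (1 * timeCutoff r δ t + t * -r t) t := fun t _ =>
    (hasDerivAt_id t).mul (hasDerivAt_timeCutoff hr δ t)
  have hc : Continuous fun t => 1 * timeCutoff r δ t + t * -r t :=
    (continuous_const.mul (continuous_timeCutoff hr δ)).add (continuous_id.mul hr.neg)
  have h := intervalIntegral.integral_eq_sub_of_hasDerivAt hd (hc.intervalIntegrable _ _)
  have h1 : timeCutoff r δ δ = 0 := intervalIntegral.integral_same
  rw [h1, mul_zero, zero_mul, sub_zero] at h
  simp only [one_mul, mul_neg, ← sub_eq_add_neg] at h
  rw [intervalIntegral.integral_sub ((continuous_timeCutoff hr δ).intervalIntegrable _ _)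
    ((by fun_prop : Continuous fun t => t * r t).intervalIntegrable _ _), sub_eq_zero] at h
  rwa [intervalIntegral.integral_of_le hδ0.le, intervalIntegral.integral_of_le hδ0.le,
    integral_Ioc_eq_integral_Ioo, integral_Ioc_eq_integral_Ioo] at h

theorem timeCutoff_zero (hδ0 : 0 < δ) : timeCutoff r δ 0 = ∫ t in Ioo 0 δ, r t := by
  rw [timeCutoff, intervalIntegral.integral_of_le hδ0.le, integral_Ioc_eq_integral_Ioo]

end TimeCutoff

/-! ### Reference measures -/

section RefMeas

variable {n : ℕ} {Γ₀ : Set (Amb n)}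

theorem refMeas_eq [IsFiniteMeasure ((surfMeas n).restrict Γ₀)] (hΓ : MeasurableSet Γ₀) (T : ℝ) :
    refMeas T Γ₀ = (((surfMeas n).restrict Γ₀).prod volume).restrict (Γ₀ ×ˢ Ioo 0 T) := by
  rw [← Measure.prod_restrict, Measure.restrict_restrict hΓ, inter_self]
  rfl

theorem ae_refMeas_mem [IsFiniteMeasure ((surfMeas n).restrict Γ₀)] (hΓ : MeasurableSet Γ₀)
    (T : ℝ) : ∀ᵐ p ∂(refMeas T Γ₀), p ∈ Γ₀ ×ˢ Ioo 0 T := by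
  rw [refMeas_eq hΓ]
  exact ae_restrict_mem (hΓ.prod measurableSet_Ioo)

theorem refMeas_absolutelyContinuous (Γ₀ : Set (Amb n)) {δ T : ℝ} (h : δ ≤ T) :
    refMeas δ Γ₀ ≪ refMeas T Γ₀ :=
  Measure.AbsolutelyContinuous.rfl.prod
    (Measure.absolutelyContinuous_of_le (Measure.restrict_mono (Ioo_subset_Ioo_right h) le_rfl))

theorem aestronglyMeasurable_refMeas [IsFiniteMeasure ((surfMeas n).restrict Γ₀)]
    (hΓ : MeasurableSet Γ₀) {T : ℝ} {Y : Type*} [TopologicalSpace Y]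
    [TopologicalSpace.PseudoMetrizableSpace Y] {f g : Amb n × ℝ → Y}
    (hg : ContinuousOn g (Γ₀ ×ˢ Ioo 0 T)) (hfg : EqOn f g (Γ₀ ×ˢ Ioo 0 T)) :
    AEStronglyMeasurable f (refMeas T Γ₀) := by
  rw [refMeas_eq hΓ]
  exact (hg.congr hfg).aestronglyMeasurable (hΓ.prod measurableSet_Ioo)

end RefMeas

/-! ### Test functions -/

namespace ShortTimeFlow

variable {n : ℕ} {T : ℝ} {Γ₀ : Set (Amb n)} {Φ : Amb n → ℝ → Amb n} (F : ShortTimeFlow T Γ₀ Φ)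
  {ψ : Amb n → ℝ} {r : ℝ → ℝ}

theorem fderiv_testFunction (hψ : ContDiff ℝ 1 ψ) (hr : Continuous r) (δ : ℝ) (y : Amb n)
    (t : ℝ) :
    fderiv ℝ (fun p : Amb n × ℝ => ψ p.1 * timeCutoff r δ p.2) (y, t) =
      ψ y • ((-r t) • ContinuousLinearMap.snd ℝ (Amb n) ℝ) +
        timeCutoff r δ t • (fderiv ℝ ψ y ∘L ContinuousLinearMap.fst ℝ (Amb n) ℝ) := by
  have h1 : HasFDerivAt (fun p : Amb n × ℝ => ψ p.1)
      (fderiv ℝ ψ y ∘L ContinuousLinearMap.fst ℝ (Amb n) ℝ) (y, t) :=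
    HasFDerivAt.comp (y, t) (hψ.differentiable (by simp) y).hasFDerivAt hasFDerivAt_fst
  have h2 : HasFDerivAt (fun p : Amb n × ℝ => timeCutoff r δ p.2)
      ((-r t) • ContinuousLinearMap.snd ℝ (Amb n) ℝ) (y, t) :=
    HasDerivAt.comp_hasFDerivAt (f := Prod.snd) (y, t) (hasDerivAt_timeCutoff hr δ t)
      hasFDerivAt_snd
  exact (h1.mul h2).fderiv

theorem materialDeriv_testFunction (h : IsMovingHypersurface T Γ₀ Φ) (hψ : ContDiff ℝ 1 ψ)
    (hr : Continuous r) (δ : ℝ) {x : Amb n} (hx : x ∈ Γ₀) {t : ℝ} (ht : t ∈ Icc 0 T) :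
    materialDeriv T Γ₀ Φ (fun p => ψ p.1 * timeCutoff r δ p.2) (Φ x t) t =
      timeCutoff r δ t * fderiv ℝ ψ (Φ x t) (timeDeriv F.G (x, t)) - ψ (Φ x t) * r t := by
  have hT : 0 < T := F.δ_pos.trans_le F.δ_le
  rw [materialDeriv, h.velocity_eq hT F.contDiff F.eq_G hx ht,
    fderiv_testFunction hψ hr]
  simp
  ring

theorem tangentialGrad_testFunction (hψ : ContDiff ℝ 1 ψ) (S : Set (Amb n)) (c : ℝ) (y : Amb n) :
    tangentialGrad S (fun z => ψ z * c) y = c • tangentProj S y (gradient ψ y) := by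
  have : gradient (fun z => ψ z * c) y = c • gradient ψ y := by
    unfold gradient
    rw [fderiv_mul_const (hψ.differentiable (by simp) y)]
    simp
  rw [tangentialGrad, this, map_smul]

theorem continuous_gradient (hψ : ContDiff ℝ 1 ψ) : Continuous (gradient ψ) :=
  (InnerProductSpace.toDual ℝ (Amb n)).symm.continuous.comp (hψ.continuous_fderiv (by simp))

/-- The test function is itself `C¹`, so a constant approximating sequence suffices and only
measurability has to be checked. -/
theorem isH1GT_testFunction (h : IsMovingHypersurface T Γ₀ Φ) (hψ : ContDiff ℝ 1 ψ)
    (hr : Continuous r) (hδ : ∀ s, F.δ ≤ s → r s = 0) :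
    IsH1GT T Γ₀ Φ (fun y t => ψ y * timeCutoff r F.δ t)
      (materialDeriv T Γ₀ Φ (fun p => ψ p.1 * timeCutoff r F.δ p.2))
      (fun y t => tangentialGrad (surf Γ₀ Φ t) (fun z => ψ z * timeCutoff r F.δ t) y)
      (fun x => ψ x * timeCutoff r F.δ 0) (fun x => ψ (Φ x T) * timeCutoff r F.δ T) := by
  have hT : 0 < T := F.δ_pos.trans_le F.δ_le
  have hfin : IsFiniteMeasure ((surfMeas n).restrict Γ₀) :=
    ⟨by simpa using h.hypersurface.surfMeas_lt_top⟩
  have hΓ : MeasurableSet Γ₀ := h.hypersurface.1.measurableSet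
  have hζ := continuous_timeCutoff hr F.δ
  have hG := F.contDiff.continuous
  have hG' := (contDiff_timeDeriv F.contDiff).continuous
  have hψ' := hψ.continuous_fderiv (by simp)
  have hIoo : ∀ {a t : ℝ}, t ∈ Ioo 0 a → t ∈ Icc 0 a := fun ht => Ioo_subset_Icc_self ht
  refine ⟨?_, ?_, ?_, ?_, ?_, fun _ p => ψ p.1 * timeCutoff r F.δ p.2, fun _ => ?_, ?_, ?_, ?_,
    ?_, ?_⟩
  · refine aestronglyMeasurable_refMeas hΓ
      (g := fun p => ψ (F.G p) * timeCutoff r F.δ p.2) (Continuous.continuousOn ?_) ?_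
    · exact (hψ.continuous.comp hG).mul (hζ.comp continuous_snd)
    · rintro ⟨x, t⟩ ⟨hx, ht⟩
      simp only [pullback, F.eq_G x hx t (hIoo ht)]
  · refine aestronglyMeasurable_refMeas hΓ
      (g := fun p => timeCutoff r F.δ p.2 * fderiv ℝ ψ (F.G p) (timeDeriv F.G p) -
        ψ (F.G p) * r p.2) (Continuous.continuousOn ?_) ?_
    · exact ((hζ.comp continuous_snd).mul ((hψ'.comp hG).clm_apply hG')).sub
        ((hψ.continuous.comp hG).mul (hr.comp continuous_snd))
    · rintro ⟨x, t⟩ ⟨hx, ht⟩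
      simp only [pullback]
      rw [F.materialDeriv_testFunction h hψ hr F.δ hx (hIoo ht), F.eq_G x hx t (hIoo ht)]
  · rw [refMeas_eq hΓ]
    -- Continuity of the tangential projection is available only up to time `δ`; afterwards the
    -- cut-off, and with it the gradient, vanishes.
    have hsub : Γ₀ ×ˢ Ioo 0 T ⊆ Γ₀ ×ˢ Icc 0 F.δ ∪ Γ₀ ×ˢ Ici F.δ := by
      rintro ⟨x, t⟩ ⟨hx, ht⟩
      rcases le_total t F.δ with h | h
      · exact Or.inl ⟨hx, ht.1.le, h⟩
      · exact Or.inr ⟨hx, h⟩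
    refine AEStronglyMeasurable.mono_set hsub (aestronglyMeasurable_union_iff.2 ⟨?_, ?_⟩)
    · refine ContinuousOn.aestronglyMeasurable ?_ (hΓ.prod measurableSet_Icc)
      have h1 : ContinuousOn (fun p : Amb n × ℝ => timeCutoff r F.δ p.2 •
          tangentProj (surf Γ₀ Φ p.2) (Φ p.1 p.2) (gradient ψ (F.G p))) (Γ₀ ×ˢ Icc 0 F.δ) :=
        (hζ.comp continuous_snd).continuousOn.smul
          (F.continuousOn_proj.clm_apply ((continuous_gradient hψ).comp hG).continuousOn)
      refine h1.congr ?_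
      rintro ⟨x, t⟩ ⟨hx, ht⟩
      simp only [pullback, tangentialGrad_testFunction hψ]
      rw [F.eq_G x hx t ⟨ht.1, ht.2.trans F.δ_le⟩]
    · refine ContinuousOn.aestronglyMeasurable ?_ (hΓ.prod measurableSet_Ici)
      refine (continuousOn_const (c := (0 : Amb n))).congr ?_
      rintro ⟨x, t⟩ ⟨hx, ht⟩
      simp only [pullback, tangentialGrad_testFunction hψ, timeCutoff_eq_zero hδ ht, zero_smul]
  · exact (hψ.continuous.mul continuous_const).aestronglyMeasurable
  · refine ContinuousOn.aestronglyMeasurable (ContinuousOn.mul ?_ continuousOn_const) hΓ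
    have h1 : Continuous fun x => ψ (F.G (x, T)) := hψ.continuous.comp (hG.comp (by fun_prop))
    exact h1.continuousOn.congr fun x hx => by rw [F.eq_G x hx T (right_mem_Icc.2 hT.le)]
  · exact (hψ.comp contDiff_fst).mul ((contDiff_timeCutoff hr F.δ).comp contDiff_snd)
  all_goals
    simp only [sub_self]
    exact tendsto_const_nhds.congr fun _ => eLpNorm_zero.symm

end ShortTimeFlow

/-! ### The entropy inequality at almost every small time -/

theorem exists_bound_of_memLp_top {α : Type*} [MeasurableSpace α] {μ : Measure α} {f : α → ℝ}
    (hf : MemLp f ⊤ μ) : ∃ M : ℝ, 0 ≤ M ∧ ∀ᵐ x ∂μ, |f x| ≤ M := by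
  refine ⟨(eLpNorm f ⊤ μ).toReal, ENNReal.toReal_nonneg, ?_⟩
  filter_upwards [ae_le_eLpNormEssSup (f := f) (μ := μ)] with x hx
  rw [← eLpNorm_exponent_top] at hx
  have := ENNReal.toReal_mono hf.2.ne hx
  simpa using this

namespace ShortTimeFlow

variable {n : ℕ} {T : ℝ} {Γ₀ : Set (Amb n)} {Φ : Amb n → ℝ → Amb n} (F : ShortTimeFlow T Γ₀ Φ)
  {ψ : Amb n → ℝ} {r : ℝ → ℝ}

/-- The entropy flux of an extension `g` of the flux, along the flow. -/
def pulledEntropyFlux (g : Amb n × ℝ × ℝ → Amb n) (η : ℝ → ℝ) (z : (Amb n × ℝ) × ℝ) : Amb n :=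
  ∫ τ in (0 : ℝ)..z.2, deriv η τ • fderiv ℝ g (F.G z.1, z.1.2, τ) (0, 0, 1)

/-- The terms of the entropy inequality which do not contain the time derivative of the cut-off
function. -/
def entropyRemainder (g : Amb n × ℝ × ℝ → Amb n) (η : ℝ → ℝ) (ψ : Amb n → ℝ)
    (z : (Amb n × ℝ) × ℝ) : ℝ :=
  η z.2 * fderiv ℝ ψ (F.G z.1) (timeDeriv F.G z.1) +
    inner ℝ (F.pulledEntropyFlux g η z)
      (tangentProj (surf Γ₀ Φ z.1.2) (Φ z.1.1 z.1.2) (gradient ψ (F.G z.1))) -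
    ψ (F.G z.1) * tangentialDiv (surf Γ₀ Φ z.1.2) (fun y => velocity T Γ₀ Φ y z.1.2)
      (Φ z.1.1 z.1.2) * (z.2 * deriv η z.2 - η z.2)

theorem continuous_pulledEntropyFlux {g : Amb n × ℝ × ℝ → Amb n} (hg : ContDiff ℝ ∞ g)
    {η : ℝ → ℝ} (hη : ContDiff ℝ 2 η) : Continuous (F.pulledEntropyFlux g η) := by
  refine intervalIntegral.continuous_parametric_intervalIntegral_of_continuous
    (f := fun (z : (Amb n × ℝ) × ℝ) τ =>
      deriv η τ • fderiv ℝ g (F.G z.1, z.1.2, τ) (0, 0, 1)) ?_ continuous_snd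
  have h1 : Continuous (deriv η) := hη.continuous_deriv (by norm_num)
  have h2 : Continuous (fderiv ℝ g) := hg.continuous_fderiv (by simp)
  have h3 := F.contDiff.continuous
  refine (h1.comp continuous_snd).smul (Continuous.clm_apply (h2.comp ?_) continuous_const)
  exact (h3.comp (continuous_fst.comp continuous_fst)).prodMk
    ((continuous_snd.comp (continuous_fst.comp continuous_fst)).prodMk continuous_snd)

theorem continuousOn_entropyRemainder {g : Amb n × ℝ × ℝ → Amb n} (hg : ContDiff ℝ ∞ g)
    {η : ℝ → ℝ} (hη : ContDiff ℝ 2 η) (hψ : ContDiff ℝ 1 ψ) :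
    ContinuousOn (F.entropyRemainder g η ψ) ((Γ₀ ×ˢ Icc 0 F.δ) ×ˢ univ) := by
  have h1 : Continuous (deriv η) := hη.continuous_deriv (by norm_num)
  have h2 := hη.continuous
  have h3 := F.contDiff.continuous.comp (continuous_fst (X := Amb n × ℝ) (Y := ℝ))
  have h4 := (contDiff_timeDeriv F.contDiff).continuous.comp
    (continuous_fst (X := Amb n × ℝ) (Y := ℝ))
  have hmaps : MapsTo Prod.fst ((Γ₀ ×ˢ Icc 0 F.δ) ×ˢ (univ : Set ℝ)) (Γ₀ ×ˢ Icc 0 F.δ) :=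
    fun z hz => hz.1
  refine ContinuousOn.sub (ContinuousOn.add ?_ (ContinuousOn.inner ?_ ?_))
    ((ContinuousOn.mul ?_ ?_).mul ?_)
  · exact ((h2.comp continuous_snd).mul
      (((hψ.continuous_fderiv (by simp)).comp h3).clm_apply h4)).continuousOn
  · exact (F.continuous_pulledEntropyFlux hg hη).continuousOn
  · exact (F.continuousOn_proj.comp continuousOn_fst hmaps).clm_apply
      ((continuous_gradient hψ).comp h3).continuousOn
  · exact (hψ.continuous.comp h3).continuousOn
  · exact F.continuousOn_div.comp continuousOn_fst hmaps
  · exact ((continuous_snd.mul (h1.comp continuous_snd)).sub (h2.comp continuous_snd)).continuousOn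

theorem entropyFlux_eq {f : Amb n → ℝ → ℝ → Amb n} {g : Amb n × ℝ × ℝ → Amb n}
    (hg : ContDiff ℝ ∞ g)
    (hfg : ∀ t ∈ Icc (0 : ℝ) T, ∀ y ∈ surf Γ₀ Φ t, ∀ s : ℝ, f y t s = g (y, t, s)) (η : ℝ → ℝ)
    {x : Amb n} (hx : x ∈ Γ₀) {t : ℝ} (ht : t ∈ Icc 0 T) (s : ℝ) :
    entropyFlux f η 0 (Φ x t) t s = F.pulledEntropyFlux g η ((x, t), s) := by
  unfold entropyFlux pulledEntropyFlux
  congr 1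
  ext1 τ
  rw [show (fun r => f (Φ x t) t r) = fun r => g (Φ x t, t, r) from
    funext fun r => hfg t ht _ ⟨x, hx, rfl⟩ r, F.eq_G x hx t ht]
  congr 1
  have h1 : HasDerivAt (fun r : ℝ => (F.G (x, t), t, r)) ((0 : Amb n), (0 : ℝ), (1 : ℝ)) τ :=
    (hasDerivAt_const τ (F.G (x, t))).prodMk ((hasDerivAt_const τ t).prodMk (hasDerivAt_id τ))
  exact (((hg.differentiable (by simp)) _).hasFDerivAt.comp_hasDerivAt τ h1).deriv

theorem entropyIntegrand_eq (h : IsMovingHypersurface T Γ₀ Φ) {f : Amb n → ℝ → ℝ → Amb n}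
    {g : Amb n × ℝ × ℝ → Amb n} (hg : ContDiff ℝ ∞ g)
    (hfg : ∀ t ∈ Icc (0 : ℝ) T, ∀ y ∈ surf Γ₀ Φ t, ∀ s : ℝ, f y t s = g (y, t, s)) (η : ℝ → ℝ)
    (hψ : ContDiff ℝ 1 ψ) (hr : Continuous r) {x : Amb n} (hx : x ∈ Γ₀) {t : ℝ}
    (ht : t ∈ Icc 0 T) (s : ℝ) :
    -(η s * materialDeriv T Γ₀ Φ (fun p => ψ p.1 * timeCutoff r F.δ p.2) (Φ x t) t) -
        inner ℝ (entropyFlux f η 0 (Φ x t) t s)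
          (tangentialGrad (surf Γ₀ Φ t) (fun z => ψ z * timeCutoff r F.δ t) (Φ x t)) +
        ψ (Φ x t) * timeCutoff r F.δ t *
          tangentialDiv (surf Γ₀ Φ t) (fun z => velocity T Γ₀ Φ z t) (Φ x t) *
          (s * deriv η s - η s) =
      r t * (η s * ψ (Φ x t)) - timeCutoff r F.δ t * F.entropyRemainder g η ψ ((x, t), s) := by
  rw [F.materialDeriv_testFunction h hψ hr F.δ hx ht, tangentialGrad_testFunction hψ,
    F.entropyFlux_eq hg hfg η hx ht, real_inner_smul_right, entropyRemainder]
  simp only [← F.eq_G x hx t ht]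
  ring

end ShortTimeFlow

section

variable {n : ℕ} {T : ℝ} {Γ₀ : Set (Amb n)} {Φ : Amb n → ℝ → Amb n}
  {f : Amb n → ℝ → ℝ → Amb n} {u₀ : Amb n → ℝ} {u : Amb n → ℝ → ℝ}

theorem ShortTimeFlow.absolutelyContinuous (F : ShortTimeFlow T Γ₀ Φ) :
    ∀ᵐ t ∂(volume.restrict (Ioo 0 F.δ)), F.κ t ≪ (surfMeas n).restrict Γ₀ := by
  filter_upwards [ae_restrict_mem measurableSet_Ioo] with t ht
  exact (Measure.absolutelyContinuous_of_le (F.kernel_le t (Ioo_subset_Icc_self ht))).trans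
    (Measure.AbsolutelyContinuous.rfl.smul_left _)

/-- With the test function `ψ ζ`, the entropy inequality reads `∫ r H - ∫ ζ J ≤ a ∫ r`, where `J`
collects the terms free of `ζ'`. The bound for `J` comes from compactness of `Γ₀ × [0,δ] × [-M,M]`
and the finite mass of the kernel. It does not depend on `r`, so the inequality can be localized in
time. -/
theorem IsEntropySolution.setIntegral_le (hu : IsEntropySolution T Γ₀ Φ f u₀ u)
    (h : IsMovingHypersurface T Γ₀ Φ) (hf : IsFlux T Γ₀ Φ f) (F : ShortTimeFlow T Γ₀ Φ)
    {η : ℝ → ℝ} (hη : ContDiff ℝ 2 η) (hη' : ∀ s, 0 ≤ deriv (deriv η) s)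
    {ψ : Amb n → ℝ} (hψ : ContDiff ℝ 1 ψ) (hψ0 : ∀ y, 0 ≤ ψ y) :
    AEStronglyMeasurable (fun t => ∫ x, η (u (Φ x t) t) * ψ (Φ x t) ∂(F.κ t))
      (volume.restrict (Ioo 0 F.δ)) ∧
    (∃ C : ℝ, 0 ≤ C ∧ ∀ᵐ t ∂(volume.restrict (Ioo 0 F.δ)),
      ‖∫ x, η (u (Φ x t) t) * ψ (Φ x t) ∂(F.κ t)‖ ≤ C) ∧
    ∃ C : ℝ, 0 ≤ C ∧ ∀ r : ℝ → ℝ, Continuous r → (∀ s, 0 ≤ r s) → (∀ s, F.δ ≤ s → r s = 0) →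
      ∫ t in Ioo 0 F.δ, r t * (∫ x, η (u (Φ x t) t) * ψ (Φ x t) ∂(F.κ t) -
        ∫ x in Γ₀, η (u₀ x) * ψ x ∂(surfMeas n) - C * t) ≤ 0 := by
  obtain ⟨g, hg, hfg, -⟩ := hf.smooth
  obtain ⟨hL, hE⟩ := hu
  have hT : 0 < T := F.δ_pos.trans_le F.δ_le
  have hfinκ := F.finite
  have hfin : IsFiniteMeasure ((surfMeas n).restrict Γ₀) :=
    ⟨by simpa using h.hypersurface.surfMeas_lt_top⟩
  have hΓ : MeasurableSet Γ₀ := h.hypersurface.1.measurableSet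
  have hsub : ∀ {t}, t ∈ Ioo 0 F.δ → t ∈ Icc 0 T := fun ht =>
    ⟨ht.1.le, ht.2.le.trans F.δ_le⟩
  set μ := (surfMeas n).restrict Γ₀
  set ν := (volume : Measure ℝ).restrict (Ioo 0 F.δ)
  have hac := F.absolutelyContinuous
  have hrac := refMeas_absolutelyContinuous Γ₀ F.δ_le
  have hU : AEStronglyMeasurable (pullback Φ u) (μ.prod ν) := hL.1.mono_ac hrac
  obtain ⟨M, -, hM⟩ := exists_bound_of_memLp_top hL
  replace hM : ∀ᵐ p ∂(μ.prod ν), |pullback Φ u p| ≤ M := hrac.ae_le hM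
  have hmem : ∀ᵐ p ∂(μ.prod ν), p ∈ Γ₀ ×ˢ Ioo 0 F.δ := ae_refMeas_mem hΓ F.δ
  set H : ℝ → ℝ := fun t => ∫ x, η (u (Φ x t) t) * ψ (Φ x t) ∂(F.κ t)
  set B : (Amb n × ℝ) × ℝ → ℝ := fun z => η z.2 * ψ (F.G z.1)
  have hB : Continuous B := (hη.continuous.comp continuous_snd).mul
    (hψ.continuous.comp (F.contDiff.continuous.comp continuous_fst))
  have hR := F.continuousOn_entropyRemainder hg hη hψ
  have hpair : AEMeasurable (fun p => (p, pullback Φ u p)) (μ.prod ν) :=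
    aemeasurable_id.prodMk hU.aemeasurable
  have hpairmem : ∀ᵐ p ∂(μ.prod ν),
      (p, pullback Φ u p) ∈ (Γ₀ ×ˢ Icc 0 F.δ) ×ˢ (univ : Set ℝ) := by
    filter_upwards [hmem] with p hp
    exact ⟨⟨hp.1, Ioo_subset_Icc_self hp.2⟩, mem_univ _⟩
  have hKm : MeasurableSet ((Γ₀ ×ˢ Icc 0 F.δ) ×ˢ (univ : Set ℝ)) :=
    (hΓ.prod measurableSet_Icc).prod .univ
  have hBm : AEStronglyMeasurable (fun p => B (p, pullback Φ u p)) (μ.prod ν) :=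
    hB.continuousOn.aestronglyMeasurable_comp hKm hpair hpairmem
  have hRm : AEStronglyMeasurable (fun p => F.entropyRemainder g η ψ (p, pullback Φ u p))
      (μ.prod ν) := hR.aestronglyMeasurable_comp hKm hpair hpairmem
  have hcomp : IsCompact ((Γ₀ ×ˢ Icc 0 F.δ) ×ˢ Icc (-M) M) :=
    (h.hypersurface.1.prod isCompact_Icc).prod isCompact_Icc
  have hbound : ∀ W : (Amb n × ℝ) × ℝ → ℝ,
      ContinuousOn W ((Γ₀ ×ˢ Icc 0 F.δ) ×ˢ univ) →
      ∃ C : ℝ, 0 ≤ C ∧ ∀ᵐ p ∂(μ.prod ν), ‖W (p, pullback Φ u p)‖ ≤ C := by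
    intro W hW
    obtain ⟨C, hC⟩ := hcomp.exists_bound_of_continuousOn
      (hW.mono (prod_mono_right (subset_univ _)))
    refine ⟨|C|, abs_nonneg C, ?_⟩
    filter_upwards [hM, hmem] with p hp hpm
    exact (hC _ ⟨⟨hpm.1, Ioo_subset_Icc_self hpm.2⟩, abs_le.1 hp⟩).trans (le_abs_self C)
  obtain ⟨CB, hCB0, hCB⟩ := hbound B hB.continuousOn
  obtain ⟨CR, hCR0, hCR⟩ := hbound _ hR
  have hκΓ : ∀ᵐ t ∂ν, ∀ᵐ x ∂(F.κ t), x ∈ Γ₀ := by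
    filter_upwards [ae_ae_kernel_of_ae_prod hac hmem] with t ht
    filter_upwards [ht] with x hx using hx.1
  have hBH : (fun t => ∫ x, B ((x, t), pullback Φ u (x, t)) ∂(F.κ t)) =ᵐ[ν] H := by
    filter_upwards [hκΓ, ae_restrict_mem measurableSet_Ioo] with t ht htm
    refine integral_congr_ae ?_
    filter_upwards [ht] with x hx
    simp only [B, pullback, F.eq_G x hx t (hsub htm)]
  have hHm : AEStronglyMeasurable H ν :=
    (aestronglyMeasurable_integral_kernel hac hBm).congr hBH
  have hHb : ∀ᵐ t ∂ν, ‖H t‖ ≤ CB * F.κ.bound.toReal := by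
    filter_upwards [ae_norm_integral_kernel_le hac hCB0 hCB, hBH] with t h1 h2
    rwa [← h2]
  refine ⟨hHm, ⟨_, by positivity, hHb⟩, CR * F.κ.bound.toReal, by positivity,
    fun r hr hr0 hrδ => ?_⟩
  set CH := CR * F.κ.bound.toReal
  set ζ := timeCutoff r F.δ
  set a := ∫ x in Γ₀, η (u₀ x) * ψ x ∂(surfMeas n)
  set J : ℝ → ℝ := fun t => ∫ x, F.entropyRemainder g η ψ ((x, t), pullback Φ u (x, t)) ∂(F.κ t)
  have hJm : AEStronglyMeasurable J ν := aestronglyMeasurable_integral_kernel hac hRm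
  have hJb : ∀ᵐ t ∂ν, ‖J t‖ ≤ CH := ae_norm_integral_kernel_le hac hCR0 hCR
  have hζc : Continuous ζ := continuous_timeCutoff hr F.δ
  have hint : ∀ k : ℝ → ℝ, Continuous k → Integrable k ν := fun k hk =>
    (hk.integrableOn_Icc (a := 0) (b := F.δ)).mono_set Ioo_subset_Icc_self
  have key := hE η hη hη' 0 _ _ _ _ _ (F.isH1GT_testFunction h hψ hr hrδ)
    (Eventually.of_forall fun p => mul_nonneg (hψ0 _) (timeCutoff_nonneg hrδ hr0 _))
    (Eventually.of_forall fun x => by rw [timeCutoff_eq_zero hrδ F.δ_le, mul_zero])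
  have ha : ∫ x in Γ₀, η (u₀ x) * (ψ x * timeCutoff r F.δ 0) ∂(surfMeas n) = ζ 0 * a := by
    rw [← integral_const_mul]
    congr 1
    ext x
    simp only [ζ]
    ring
  rw [ha, setIntegral_eq_of_subset_of_forall_sdiff_eq_zero measurableSet_Ioo
    (Ioo_subset_Ioo_right F.δ_le)] at key
  swap
  · rintro t ⟨htT, htδ⟩
    have ht : F.δ ≤ t := by
      by_contra hlt
      exact htδ ⟨htT.1, not_le.1 hlt⟩
    refine (setIntegral_congr_fun
      (h.isCompact_surf (Ioo_subset_Icc_self htT)).measurableSet (g := fun _ => 0) ?_).trans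
      (by simp)
    rintro _ ⟨x, hx, rfl⟩
    have := F.entropyIntegrand_eq h hg hfg η hψ hr hx (Ioo_subset_Icc_self htT) (u (Φ x t) t)
    rw [hrδ t ht, timeCutoff_eq_zero hrδ ht] at this
    simpa [timeCutoff_eq_zero hrδ ht] using this
  have hI : ∀ᵐ t ∂ν, ∫ y in surf Γ₀ Φ t, (-(η (u y t) *
        materialDeriv T Γ₀ Φ (fun p => ψ p.1 * timeCutoff r F.δ p.2) y t) -
        inner ℝ (entropyFlux f η 0 y t (u y t))
          (tangentialGrad (surf Γ₀ Φ t) (fun z => ψ z * timeCutoff r F.δ t) y) +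
        ψ y * timeCutoff r F.δ t *
          tangentialDiv (surf Γ₀ Φ t) (fun z => velocity T Γ₀ Φ z t) y *
          (u y t * deriv η (u y t) - η (u y t))) ∂(surfMeas n) = r t * H t - ζ t * J t := by
    filter_upwards [hκΓ, ae_restrict_mem measurableSet_Ioo, ae_aestronglyMeasurable_kernel hac hBm,
      ae_aestronglyMeasurable_kernel hac hRm, ae_ae_kernel_of_ae_prod hac hCB,
      ae_ae_kernel_of_ae_prod hac hCR, hBH] with t h1 h2 h3 h4 h5 h6 h7
    have hB' : Integrable (fun x => B ((x, t), pullback Φ u (x, t))) (F.κ t) :=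
      ⟨h3, HasFiniteIntegral.of_bounded h5⟩
    have hR' : Integrable (fun x => F.entropyRemainder g η ψ ((x, t), pullback Φ u (x, t)))
        (F.κ t) := ⟨h4, HasFiniteIntegral.of_bounded h6⟩
    have heq : (fun x => r t * B ((x, t), pullback Φ u (x, t)) -
        ζ t * F.entropyRemainder g η ψ ((x, t), pullback Φ u (x, t))) =ᵐ[F.κ t]
        fun x => -(η (u (Φ x t) t) *
        materialDeriv T Γ₀ Φ (fun p => ψ p.1 * timeCutoff r F.δ p.2) (Φ x t) t) -
        inner ℝ (entropyFlux f η 0 (Φ x t) t (u (Φ x t) t))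
          (tangentialGrad (surf Γ₀ Φ t) (fun z => ψ z * timeCutoff r F.δ t) (Φ x t)) +
        ψ (Φ x t) * timeCutoff r F.δ t *
          tangentialDiv (surf Γ₀ Φ t) (fun z => velocity T Γ₀ Φ z t) (Φ x t) *
          (u (Φ x t) t * deriv η (u (Φ x t) t) - η (u (Φ x t) t)) := by
      filter_upwards [h1] with x hx
      rw [F.entropyIntegrand_eq h hg hfg η hψ hr hx (hsub h2)]
      simp only [B, ζ, pullback, F.eq_G x hx t (hsub h2)]
    rw [F.integral_eq t (Ioo_subset_Icc_self h2) (fun y => -(η (u y t) *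
        materialDeriv T Γ₀ Φ (fun p => ψ p.1 * timeCutoff r F.δ p.2) y t) -
        inner ℝ (entropyFlux f η 0 y t (u y t))
          (tangentialGrad (surf Γ₀ Φ t) (fun z => ψ z * timeCutoff r F.δ t) y) +
        ψ y * timeCutoff r F.δ t *
          tangentialDiv (surf Γ₀ Φ t) (fun z => velocity T Γ₀ Φ z t) y *
          (u y t * deriv η (u y t) - η (u y t)))
      (((hB'.const_mul (r t)).sub (hR'.const_mul (ζ t))).aestronglyMeasurable.congr heq),
      ← integral_congr_ae heq, integral_sub (hB'.const_mul _) (hR'.const_mul _),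
      integral_const_mul, integral_const_mul, h7]
  rw [integral_congr_ae hI] at key
  have hrH : Integrable (fun t => r t * H t) ν := (hint r hr).mul_bdd hHm hHb
  have hζJ : Integrable (fun t => ζ t * J t) ν := (hint ζ hζc).mul_bdd hJm hJb
  have hζC : Integrable (fun t => ζ t * CH) ν := (hint ζ hζc).mul_const _
  have htr : Integrable (fun t => t * r t) ν := hint _ (continuous_id.mul hr)
  have hmono : ∫ t, ζ t * J t ∂ν ≤ ∫ t, ζ t * CH ∂ν := by
    refine integral_mono_ae hζJ hζC ?_
    filter_upwards [hJb] with t ht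
    exact mul_le_mul_of_nonneg_left ((le_abs_self _).trans ht) (timeCutoff_nonneg hrδ hr0 t)
  rw [integral_sub hrH hζJ, show ζ 0 = ∫ t, r t ∂ν from timeCutoff_zero F.δ_pos] at key
  rw [integral_mul_const, setIntegral_timeCutoff hr F.δ_pos] at hmono
  have hsplit : ∫ t, r t * (H t - a - CH * t) ∂ν =
      ∫ t, r t * H t ∂ν - (∫ t, r t ∂ν) * a - (∫ t, t * r t ∂ν) * CH := by
    have hrHa : Integrable (fun t => r t * H t - r t * a) ν := hrH.sub ((hint r hr).mul_const a)
    rw [← integral_mul_const, ← integral_mul_const, ← integral_sub hrH ((hint r hr).mul_const a),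
      ← integral_sub hrHa (htr.mul_const CH)]
    congr 1
    ext t
    ring
  rw [hsplit]
  linarith

theorem IsEntropySolution.ae_integral_le (hu : IsEntropySolution T Γ₀ Φ f u₀ u)
    (h : IsMovingHypersurface T Γ₀ Φ) (hf : IsFlux T Γ₀ Φ f) (F : ShortTimeFlow T Γ₀ Φ)
    {η : ℝ → ℝ} (hη : ContDiff ℝ 2 η) (hη' : ∀ s, 0 ≤ deriv (deriv η) s)
    {ψ : Amb n → ℝ} (hψ : ContDiff ℝ 1 ψ) (hψ0 : ∀ y, 0 ≤ ψ y) :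
    ∃ C : ℝ, ∀ᵐ t ∂(volume.restrict (Ioo 0 F.δ)),
      ∫ x, η (u (Φ x t) t) * ψ (Φ x t) ∂(F.κ t) ≤
        ∫ x in Γ₀, η (u₀ x) * ψ x ∂(surfMeas n) + C * t := by
  obtain ⟨hHm, ⟨CB, hCB0, hHb⟩, C, hC0, hle⟩ := hu.setIntegral_le h hf F hη hη' hψ hψ0
  set H : ℝ → ℝ := fun t => ∫ x, η (u (Φ x t) t) * ψ (Φ x t) ∂(F.κ t)
  set a := ∫ x in Γ₀, η (u₀ x) * ψ x ∂(surfMeas n)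
  -- Admissible densities must vanish from time `δ` on. This weight enforces that for arbitrary `ρ`
  -- and, being positive on `(0, δ)`, is divided out at the end.
  have hw : Continuous fun t => max (F.δ - t) 0 := by fun_prop
  refine ⟨C, ?_⟩
  have hae : (fun t => max (F.δ - t) 0 * (H t - a - C * t))
      ≤ᵐ[volume.restrict (Ioo 0 F.δ)] 0 := by
    refine ae_le_zero_of_forall_integral_mul_le (C := F.δ * (CB + |a| + C * F.δ)) ?_ ?_ ?_
    · exact hw.aestronglyMeasurable.mul
        ((hHm.sub aestronglyMeasurable_const).sub (by fun_prop : Continuous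
          fun t => C * t).aestronglyMeasurable)
    · filter_upwards [hHb, ae_restrict_mem measurableSet_Ioo] with t h1 h2
      rw [norm_mul]
      have h3 : ‖max (F.δ - t) 0‖ ≤ F.δ := by
        rw [Real.norm_of_nonneg (le_max_right _ _)]
        exact max_le (by linarith [h2.1]) F.δ_pos.le
      have h4 : ‖H t - a - C * t‖ ≤ CB + |a| + C * F.δ := by
        refine (norm_sub_le _ _).trans (add_le_add ((norm_sub_le _ _).trans
          (add_le_add h1 le_rfl)) ?_)
        rw [Real.norm_of_nonneg (mul_nonneg hC0 h2.1.le)]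
        exact mul_le_mul_of_nonneg_left h2.2.le hC0
      exact mul_le_mul h3 h4 (norm_nonneg _) F.δ_pos.le
    · intro ρ hρ hρ0 _
      have := hle (fun t => ρ t * max (F.δ - t) 0) (hρ.mul hw)
        (fun s => mul_nonneg (hρ0 s) (le_max_right _ _))
        (fun s hs => by simp [hs])
      simpa only [mul_assoc] using this
  filter_upwards [hae, ae_restrict_mem measurableSet_Ioo] with t h1 h2
  have h3 : 0 < F.δ - t := sub_pos.2 h2.2
  simp only [max_eq_left h3.le, Pi.zero_apply] at h1
  have h4 := nonpos_of_mul_nonpos_right h1 h3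
  linarith

end

/-! ### Attainment of the initial value -/

theorem MeasureTheory.Integrable.exists_contDiff_nonneg_integral_sub_le {E : Type*}
    [NormedAddCommGroup E] [NormedSpace ℝ E] [FiniteDimensional ℝ E] [MeasurableSpace E]
    [BorelSpace E] {μ : Measure E} [IsFiniteMeasure μ] {p : E → ℝ} (hp : Integrable p μ)
    (hp0 : ∀ᵐ x ∂μ, 0 ≤ p x) {ε : ℝ} (hε : 0 < ε) :
    ∃ ψ : E → ℝ, ContDiff ℝ ∞ ψ ∧ (∀ x, 0 ≤ ψ x) ∧ Integrable ψ μ ∧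
      ∫ x, |p x - ψ x| ∂μ ≤ ε := by
  have : ProperSpace E := FiniteDimensional.proper ℝ E
  set m := μ.real univ
  have hm : 0 ≤ m := measureReal_nonneg
  -- Smoothing and shifting each cost `e` pointwise, hence at most `2 e m ≤ ε / 2` in total; the
  -- other half of `ε` pays for the continuous approximation.
  set e := ε / (4 * (m + 1))
  have he : 0 < e := by positivity
  obtain ⟨g, hgs, hg, hgc, hgi⟩ := hp.exists_hasCompactSupport_integral_sub_le (half_pos hε)
  have hgu : UniformContinuous fun x => |g x| :=
    hgs.abs.uniformContinuous_of_continuous hgc.abs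
  obtain ⟨φ, hφ, hφg⟩ := hgu.exists_contDiff_dist_le he
  have hφi : Integrable φ μ := by
    refine (hgi.abs.add (integrable_const e)).mono' hφ.continuous.aestronglyMeasurable
      (Eventually.of_forall fun x => ?_)
    have := (hφg x).le
    rw [Real.dist_eq, abs_le] at this
    have h1 := abs_nonneg (g x)
    rw [Real.norm_eq_abs, abs_le]
    simp only [Pi.add_apply]
    constructor <;> linarith
  -- Since `φ` lies within `e` of `|g| ≥ 0`, adding `e` makes it nonnegative.
  refine ⟨fun x => φ x + e, hφ.add contDiff_const, fun x => ?_, hφi.add (integrable_const e), ?_⟩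
  · have := (hφg x).le
    rw [Real.dist_eq, abs_le] at this
    have h1 := abs_nonneg (g x)
    linarith
  · have hle : ∫ x, |p x - (φ x + e)| ∂μ ≤ ∫ x, (‖p x - g x‖ + 2 * e) ∂μ := by
      refine integral_mono_ae (hp.sub (hφi.add (integrable_const e))).abs
        ((hp.sub hgi).norm.add (integrable_const _)) ?_
      filter_upwards [hp0] with x hx
      have h1 := (hφg x).le
      rw [Real.dist_eq, abs_le] at h1
      have h2 := abs_abs_sub_abs_le_abs_sub (p x) (g x)
      rw [abs_of_nonneg hx, abs_le] at h2
      simp only [Real.norm_eq_abs]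
      rw [abs_le]
      constructor <;> linarith
    refine hle.trans ?_
    have hpg : Integrable (fun x => ‖p x - g x‖) μ := (hp.sub hgi).norm
    rw [integral_add hpg (integrable_const _), integral_const, smul_eq_mul]
    have h2 : m * (2 * e) ≤ ε / 2 := by
      have : (m + 1) * (2 * e) = ε / 2 := by
        simp only [e]
        field_simp
        norm_num
      nlinarith
    linarith

/-- The square is expanded with respect to `κ`, where the entropy bounds live. `h₁` controls `∫ p²`;
in the cross term `p₀` is replaced by `ψ'` so that `h₂` applies, and then `∫ p₀ ψ` by `∫ p₀²`. The
leading terms combine to `(1 + L - 2) ∫ p₀²`, small when `L` is near 1. Below, `ψ'` is `ψ`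
transported by the flow and `w` its displacement. -/
theorem integral_sq_sub_le {X : Type*} [MeasurableSpace X] {μ κ : Measure X} [IsFiniteMeasure μ]
    [IsFiniteMeasure κ] {L K w ε c₁ c₂ : ℝ} (hL : 0 ≤ L) (hK : 0 ≤ K)
    (hκμ : κ ≤ ENNReal.ofReal L • μ) (hμκ : μ ≤ ENNReal.ofReal L • κ) {p p₀ ψ ψ' : X → ℝ}
    (hp : AEStronglyMeasurable p μ) (hp₀ : AEStronglyMeasurable p₀ μ)
    (hpK : ∀ᵐ x ∂μ, |p x| ≤ K) (hp₀K : ∀ᵐ x ∂μ, |p₀ x| ≤ K)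
    (hψ : Integrable ψ μ) (hψ' : AEStronglyMeasurable ψ' μ)
    (hw : ∀ᵐ x ∂μ, |ψ x - ψ' x| ≤ w) (hw0 : 0 ≤ w) (hε : ∫ x, |p₀ x - ψ x| ∂μ ≤ ε)
    (h₁ : ∫ x, p x ^ 2 ∂κ ≤ ∫ x, p₀ x ^ 2 ∂μ + c₁)
    (h₂ : -∫ x, p x * ψ' x ∂κ ≤ -∫ x, p₀ x * ψ x ∂μ + c₂) :
    ∫ x, (p x - p₀ x) ^ 2 ∂μ ≤
      L * ((L - 1) * ∫ x, p₀ x ^ 2 ∂μ + c₁ + 2 * c₂ + 2 * K * ε * (1 + L) +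
        2 * K * w * L * μ.real univ) := by
  have hac : κ ≪ μ := (Measure.absolutelyContinuous_of_le hκμ).trans
    (Measure.AbsolutelyContinuous.rfl.smul_left _)
  have hmono : ∀ (μ₁ μ₂ : Measure X) (g : X → ℝ), μ₁ ≤ ENNReal.ofReal L • μ₂ →
      (∀ x, 0 ≤ g x) → Integrable g μ₂ → ∫ x, g x ∂μ₁ ≤ L * ∫ x, g x ∂μ₂ := by
    intro μ₁ μ₂ g hle hg hgi
    have := integral_mono_measure hle (Eventually.of_forall hg)
      (hgi.smul_measure ENNReal.ofReal_ne_top)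
    rwa [integral_smul_measure, ENNReal.toReal_ofReal hL, smul_eq_mul] at this
  have htr : ∀ g : X → ℝ, Integrable g μ → Integrable g κ := fun g hg =>
    (hg.smul_measure ENNReal.ofReal_ne_top).mono_measure hκμ
  have hpi : Integrable p μ := ⟨hp, HasFiniteIntegral.of_bounded hpK⟩
  have hp₀i : Integrable p₀ μ := ⟨hp₀, HasFiniteIntegral.of_bounded hp₀K⟩
  have hpκ : AEStronglyMeasurable p κ := hp.mono_ac hac
  have hψ'i : Integrable ψ' μ := by
    have hd : Integrable (fun x => ψ x - ψ' x) μ :=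
      ⟨hψ.1.sub hψ', HasFiniteIntegral.of_bounded hw⟩
    refine (hψ.sub hd).congr (Eventually.of_forall fun x => ?_)
    simp
  have hpp : Integrable (fun x => p x ^ 2) μ := by
    simpa only [sq] using hpi.mul_bdd hp hpK
  have hp₀p₀ : Integrable (fun x => p₀ x ^ 2) μ := by
    simpa only [sq] using hp₀i.mul_bdd hp₀ hp₀K
  have hpp₀ : Integrable (fun x => p x * p₀ x) μ := hpi.mul_bdd hp₀ hp₀K
  have hpψ' : Integrable (fun x => p x * ψ' x) μ := hψ'i.bdd_mul hp hpK
  have hp₀ψ : Integrable (fun x => p₀ x * ψ x) μ := hψ.bdd_mul hp₀ hp₀K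
  have hd : Integrable (fun x => |p₀ x - ψ x|) μ := (hp₀i.sub hψ).abs
  have hsq : Integrable (fun x => (p x - p₀ x) ^ 2) μ := by
    refine ((hpp.sub (hpp₀.const_mul 2)).add hp₀p₀).congr (Eventually.of_forall fun x => ?_)
    simp only [Pi.add_apply, Pi.sub_apply]
    ring
  set A := ∫ x, p₀ x ^ 2 ∂μ
  have e1 : ∫ x, (p x - p₀ x) ^ 2 ∂μ ≤ L * ∫ x, (p x - p₀ x) ^ 2 ∂κ :=
    hmono _ _ _ hμκ (fun x => sq_nonneg _) (htr _ hsq)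
  have e2 : ∫ x, (p x - p₀ x) ^ 2 ∂κ =
      ∫ x, p x ^ 2 ∂κ - 2 * ∫ x, p x * p₀ x ∂κ + ∫ x, p₀ x ^ 2 ∂κ := by
    have hi : Integrable (fun x => p x ^ 2 - 2 * (p x * p₀ x)) κ :=
      (htr _ hpp).sub ((htr _ hpp₀).const_mul 2)
    rw [← integral_const_mul, ← integral_sub (htr _ hpp) ((htr _ hpp₀).const_mul 2),
      ← integral_add hi (htr _ hp₀p₀)]
    congr 1
    ext x
    ring
  have e3 : ∫ x, p₀ x ^ 2 ∂κ ≤ L * A := hmono _ _ _ hκμ (fun x => sq_nonneg _) hp₀p₀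
  have e4 : ∫ x, p x * ψ' x ∂κ - ∫ x, p x * p₀ x ∂κ ≤ L * (K * ε + K * w * μ.real univ) := by
    have hb : Integrable (fun x => K * |p₀ x - ψ x| + K * w) μ :=
      (hd.const_mul K).add (integrable_const _)
    have hle : ∫ x, (p x * ψ' x - p x * p₀ x) ∂κ ≤ ∫ x, (K * |p₀ x - ψ x| + K * w) ∂κ := by
      refine integral_mono_ae ((htr _ hpψ').sub (htr _ hpp₀)) (htr _ hb) ?_
      filter_upwards [hac.ae_le hpK, hac.ae_le hw] with x h1 h2
      calc p x * ψ' x - p x * p₀ x ≤ |p x * (ψ' x - p₀ x)| := by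
            rw [← mul_sub]; exact le_abs_self _
        _ = |p x| * |(p₀ x - ψ x) + (ψ x - ψ' x)| := by
            rw [abs_mul, abs_sub_comm]; congr 2; ring
        _ ≤ K * (|p₀ x - ψ x| + w) := by
            gcongr
            exact (abs_add_le _ _).trans (by gcongr)
        _ = _ := by ring
    rw [integral_sub (htr _ hpψ') (htr _ hpp₀)] at hle
    refine hle.trans ((hmono _ _ _ hκμ (fun x => by positivity) hb).trans ?_)
    rw [integral_add (hd.const_mul K) (integrable_const _), integral_const_mul, integral_const,
      smul_eq_mul]
    have : K * ∫ x, |p₀ x - ψ x| ∂μ ≤ K * ε := by gcongr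
    refine mul_le_mul_of_nonneg_left ?_ hL
    linarith
  have e5 : A - ∫ x, p₀ x * ψ x ∂μ ≤ K * ε := by
    have hle : ∫ x, (p₀ x ^ 2 - p₀ x * ψ x) ∂μ ≤ ∫ x, K * |p₀ x - ψ x| ∂μ := by
      refine integral_mono_ae (hp₀p₀.sub hp₀ψ) (hd.const_mul K) ?_
      filter_upwards [hp₀K] with x h1
      calc p₀ x ^ 2 - p₀ x * ψ x = p₀ x * (p₀ x - ψ x) := by ring
        _ ≤ |p₀ x * (p₀ x - ψ x)| := le_abs_self _
        _ = |p₀ x| * |p₀ x - ψ x| := abs_mul _ _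
        _ ≤ _ := by gcongr
    rw [integral_sub hp₀p₀ hp₀ψ, integral_const_mul] at hle
    have : K * ∫ x, |p₀ x - ψ x| ∂μ ≤ K * ε := by gcongr
    linarith
  refine e1.trans (mul_le_mul_of_nonneg_left ?_ hL)
  rw [e2]
  linarith

section

variable {n : ℕ} {T : ℝ} {Γ₀ : Set (Amb n)} {Φ : Amb n → ℝ → Amb n}
  {f : Amb n → ℝ → ℝ → Amb n} {u₀ : Amb n → ℝ} {u : Amb n → ℝ → ℝ}

theorem ShortTimeFlow.exists_abs_sub_le (F : ShortTimeFlow T Γ₀ Φ)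
    (h : IsMovingHypersurface T Γ₀ Φ) {ψ : Amb n → ℝ} (hψ : ContDiff ℝ 1 ψ) :
    ∃ C : ℝ, 0 ≤ C ∧ ∀ x ∈ Γ₀, ∀ t ∈ Icc 0 T, |ψ x - ψ (Φ x t)| ≤ C * t := by
  have hcomp : IsCompact (F.G '' (Γ₀ ×ˢ Icc 0 T)) :=
    (h.hypersurface.1.prod isCompact_Icc).image F.contDiff.continuous
  obtain ⟨D, hD⟩ := (hψ.locallyLipschitz.locallyLipschitzOn
    (s := F.G '' (Γ₀ ×ˢ Icc 0 T))).exists_lipschitzOnWith_of_compact hcomp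
  have hT : 0 < T := F.δ_pos.trans_le F.δ_le
  have h0 : (0 : ℝ) ∈ Icc 0 T := left_mem_Icc.2 hT.le
  refine ⟨D * F.C, mul_nonneg D.coe_nonneg F.C_nonneg, fun x hx t ht => ?_⟩
  have h1 := hD.dist_le_mul x ⟨(x, 0), ⟨hx, h0⟩, by rw [← F.eq_G x hx 0 h0, h.initial x hx]⟩
    (Φ x t) ⟨(x, t), ⟨hx, ht⟩, (F.eq_G x hx t ht).symm⟩
  rw [Real.dist_eq, dist_comm, dist_eq_norm] at h1
  calc _ ≤ D * ‖Φ x t - x‖ := h1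
    _ ≤ D * (F.C * t) := by
        gcongr
        exact F.dist_le x hx t ht
    _ = _ := by ring

/-- For every `ε > 0`, at almost every small time the `L²` distance to the initial value is bounded
by a continuous function of time which is small at time zero. -/
theorem IsEntropySolution.exists_continuous_bound (hu : IsEntropySolution T Γ₀ Φ f u₀ u)
    (h : IsMovingHypersurface T Γ₀ Φ) (hf : IsFlux T Γ₀ Φ f) (F : ShortTimeFlow T Γ₀ Φ)
    (hu₀ : MemLp u₀ ⊤ ((surfMeas n).restrict Γ₀)) {M : ℝ} (hM0 : 0 ≤ M)
    (hM : ∀ᵐ x ∂((surfMeas n).restrict Γ₀), |u₀ x| ≤ M) {ε : ℝ} (hε : 0 < ε) :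
    ∃ b : ℝ → ℝ, Continuous b ∧ b 0 < ε ∧ ∀ᵐ t ∂(volume.restrict (Ioo 0 F.δ)),
      AEStronglyMeasurable (fun x => u (Φ x t) t) ((surfMeas n).restrict Γ₀) →
      (∀ᵐ x ∂((surfMeas n).restrict Γ₀), |u (Φ x t) t| ≤ M) →
      ∫ x in Γ₀, |u (Φ x t) t - u₀ x| ^ 2 ∂(surfMeas n) ≤ b t := by
  have hfinκ := F.finite
  have hfin : IsFiniteMeasure ((surfMeas n).restrict Γ₀) :=
    ⟨by simpa using h.hypersurface.surfMeas_lt_top⟩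
  have hΓ : MeasurableSet Γ₀ := h.hypersurface.1.measurableSet
  set μ := (surfMeas n).restrict Γ₀
  have hΓμ : ∀ᵐ x ∂μ, x ∈ Γ₀ := ae_restrict_mem hΓ
  set K := 2 * M
  have hK : 0 ≤ K := by positivity
  set p₀ : Amb n → ℝ := fun x => u₀ x + M
  have hp₀m : AEStronglyMeasurable p₀ μ := hu₀.1.add aestronglyMeasurable_const
  have hp₀ : ∀ᵐ x ∂μ, 0 ≤ p₀ x ∧ |p₀ x| ≤ K := by
    filter_upwards [hM] with x hx
    have := abs_le.1 hx
    have h0 : 0 ≤ p₀ x := by simp only [p₀]; linarith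
    refine ⟨h0, ?_⟩
    rw [abs_of_nonneg h0]
    simp only [p₀, K]
    linarith
  have hp₀i : Integrable p₀ μ :=
    ⟨hp₀m, HasFiniteIntegral.of_bounded (hp₀.mono fun x hx => hx.2)⟩
  -- At `t = 0` the final bound reduces to `4 K e`, which must be less than `ε`.
  set e := ε / (4 * K + 1)
  have he : 0 < e := by positivity
  obtain ⟨ψ, hψ, hψ0, hψi, hψe⟩ := hp₀i.exists_contDiff_nonneg_integral_sub_le
    (hp₀.mono fun x hx => hx.1) he
  have hψ1 : ContDiff ℝ 1 ψ := hψ.of_le (by simp)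
  obtain ⟨C₁, hC₁⟩ := hu.ae_integral_le h hf F (η := fun s => (s + M) ^ 2) (by fun_prop)
    (fun s => by
      have : deriv (fun s : ℝ => (s + M) ^ 2) = fun s => 2 * (s + M) := by
        ext s
        simp [deriv_fun_pow]
      rw [this]
      simp)
    (ψ := fun _ => 1) contDiff_const (fun _ => zero_le_one)
  obtain ⟨C₂, hC₂⟩ := hu.ae_integral_le h hf F (η := fun s => -(s + M)) (by fun_prop)
    (fun s => by
      have : deriv (fun s : ℝ => -(s + M)) = fun s => -1 := by
        ext s
        simp
      rw [this]
      simp) hψ1 hψ0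
  obtain ⟨D, hD0, hD⟩ := F.exists_abs_sub_le h hψ1
  set A := ∫ x, p₀ x ^ 2 ∂μ
  -- This is the bound of `integral_sq_sub_le` with `L = (1 + C t)^n`, `w = D t`, `c₁ = C₁ t` and
  -- `c₂ = C₂ t`.
  refine ⟨fun t => (1 + F.C * t) ^ n * (((1 + F.C * t) ^ n - 1) * A + C₁ * t + 2 * (C₂ * t) +
    2 * K * e * (1 + (1 + F.C * t) ^ n) + 2 * K * (D * t) * (1 + F.C * t) ^ n * μ.real univ),
    by fun_prop, ?_, ?_⟩
  · have h1 : e * (4 * K + 1) = ε := by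
      simp only [e]
      field_simp
    simp only [mul_zero, add_zero, one_pow, sub_self, zero_mul, one_mul, zero_add]
    linarith
  · filter_upwards [hC₁, hC₂, ae_restrict_mem measurableSet_Ioo] with t h1 h2 ht hUm hUM
    have ht' : t ∈ Icc 0 T := ⟨ht.1.le, ht.2.le.trans F.δ_le⟩
    have hL : 0 ≤ 1 + F.C * t := by
      have := mul_nonneg F.C_nonneg ht.1.le
      linarith
    have hkl := F.kernel_le t (Ioo_subset_Icc_self ht)
    have hlk := F.le_kernel t (Ioo_subset_Icc_self ht)
    rw [← ENNReal.ofReal_pow hL] at hkl hlk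
    have hpK : ∀ᵐ x ∂μ, |u (Φ x t) t + M| ≤ K := by
      filter_upwards [hUM] with x hx
      have := abs_le.1 hx
      rw [abs_le]
      constructor <;> simp only [K] <;> linarith
    have hψ' : AEStronglyMeasurable (fun x => ψ (Φ x t)) μ := by
      have hc : Continuous fun x => ψ (F.G (x, t)) :=
        hψ.continuous.comp (F.contDiff.continuous.comp (by fun_prop))
      exact (hc.continuousOn.congr fun x hx => by
        rw [F.eq_G x hx t ht']).aestronglyMeasurable hΓ
    have hfinal := integral_sq_sub_le (pow_nonneg hL n) hK hkl hlk
      (p := fun x => u (Φ x t) t + M) (p₀ := p₀) (ψ := ψ) (ψ' := fun x => ψ (Φ x t))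
      (c₁ := C₁ * t) (c₂ := C₂ * t) (hUm.add aestronglyMeasurable_const) hp₀m hpK
      (hp₀.mono fun x hx => hx.2) hψi hψ' (w := D * t)
      (hΓμ.mono fun x hx => hD x hx t ht') (mul_nonneg hD0 ht.1.le) hψe
      (by simpa only [mul_one] using h1)
      (by simpa only [neg_mul, integral_neg] using h2)
    refine le_of_eq_of_le (integral_congr_ae (Eventually.of_forall fun x => ?_)) hfinal
    simp only [p₀, sq_abs]
    ring

end

theorem mainTheorem8 (n : ℕ) (T : ℝ) (hT : 0 < T) (Γ₀ : Set (Amb n)) (Φ : Amb n → ℝ → Amb n)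
    (hΦ : IsMovingHypersurface T Γ₀ Φ) (f : Amb n → ℝ → ℝ → Amb n) (hf : IsFlux T Γ₀ Φ f)
    (u₀ : Amb n → ℝ) (hu₀ : MemLp u₀ ∞ ((surfMeas n).restrict Γ₀))
    (u : Amb n → ℝ → ℝ) (hu : IsEntropySolution T Γ₀ Φ f u₀ u) :
    ∃ N : Set ℝ, N ⊆ Icc 0 T ∧ volume N = 0 ∧
      (∀ t ∈ Icc 0 T \ N,
        IntegrableOn (fun x => |u (Φ x t) t - u₀ x| ^ 2) Γ₀ (surfMeas n)) ∧
      Tendsto (fun t => ∫ x in Γ₀, |u (Φ x t) t - u₀ x| ^ 2 ∂(surfMeas n))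
        (𝓝[Icc 0 T \ N] 0) (𝓝 0) := by
  obtain ⟨F⟩ := hΦ.nonempty_shortTimeFlow hT
  have hfin : IsFiniteMeasure ((surfMeas n).restrict Γ₀) :=
    ⟨by simpa using hΦ.hypersurface.surfMeas_lt_top⟩
  set μ := (surfMeas n).restrict Γ₀
  obtain ⟨M₁, hM₁0, hM₁⟩ := exists_bound_of_memLp_top hu.1
  obtain ⟨M₂, hM₂0, hM₂⟩ := exists_bound_of_memLp_top hu₀
  set M := max M₁ M₂
  have hM0 : 0 ≤ M := hM₁0.trans (le_max_left _ _)
  have hM : ∀ᵐ x ∂μ, |u₀ x| ≤ M := hM₂.mono fun x hx => hx.trans (le_max_right _ _)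
  -- The null set of times depends on the accuracy, through the choice of `ψ`. Restricting to `1 /
  -- (k + 1)` keeps the union null.
  choose b hbc hb0 hb using fun k : ℕ =>
    hu.exists_continuous_bound hΦ hf F hu₀ hM0 hM (Nat.one_div_pos_of_nat (α := ℝ) (n := k))
  have hconst : ∀ᵐ t ∂((volume : Measure ℝ).restrict (Ioo 0 T)), Kernel.const ℝ μ t ≪ μ :=
    Eventually.of_forall fun t => by rw [Kernel.const_apply]
  have hmeas := ae_aestronglyMeasurable_kernel hconst hu.1.1
  have hbdd := ae_ae_kernel_of_ae_prod hconst hM₁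
  simp only [Kernel.const_apply] at hmeas hbdd
  rw [ae_restrict_iff' measurableSet_Ioo] at hmeas hbdd
  have hball := ae_all_iff.2 hb
  rw [ae_restrict_iff' measurableSet_Ioo] at hball
  -- Integrability is required at every retained time in `(0, T)`, whereas the quantitative bounds
  -- are available only before `δ`. The endpoints `0` and `T` are discarded.
  set good : ℝ → Prop := fun t => t ∈ Ioo 0 T ∧
    AEStronglyMeasurable (fun x => u (Φ x t) t) μ ∧ (∀ᵐ x ∂μ, |u (Φ x t) t| ≤ M) ∧
    (t < F.δ → ∀ k, ∫ x in Γ₀, |u (Φ x t) t - u₀ x| ^ 2 ∂(surfMeas n) ≤ b k t)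
  have hgood : ∀ᵐ t, t ∈ Ioo 0 T → good t := by
    filter_upwards [hmeas, hbdd, hball] with t h1 h2 h3 ht
    have h4 : ∀ᵐ x ∂μ, |u (Φ x t) t| ≤ M :=
      (h2 ht).mono fun x hx => hx.trans (le_max_left _ _)
    exact ⟨ht, h1 ht, h4, fun htδ k => h3 ⟨ht.1, htδ⟩ k (h1 ht) h4⟩
  have hmem : ∀ t ∈ Icc 0 T \ {t | t ∈ Icc 0 T ∧ ¬ good t}, good t := fun t ht => by
    by_contra hn
    exact ht.2 ⟨ht.1, hn⟩
  refine ⟨{t | t ∈ Icc 0 T ∧ ¬ good t}, fun t ht => ht.1, ?_, fun t ht => ?_, ?_⟩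
  · refine measure_mono_null (t := {0, T} ∪ {t | ¬ (t ∈ Ioo 0 T → good t)}) ?_
      (measure_union_null ((toFinite {0, T}).measure_zero _) hgood)
    rintro t ⟨ht, hn⟩
    by_cases h1 : t ∈ Ioo 0 T
    · exact Or.inr fun h2 => hn (h2 h1)
    · left
      rcases eq_or_lt_of_le ht.1 with h2 | h2
      · exact Or.inl h2.symm
      · rcases eq_or_lt_of_le ht.2 with h3 | h3
        · exact Or.inr h3
        · exact absurd ⟨h2, h3⟩ h1
  · obtain ⟨-, h1, h2, -⟩ := hmem t ht
    refine ⟨((h1.sub hu₀.1).norm.pow 2), HasFiniteIntegral.of_bounded (C := (M + M) ^ 2) ?_⟩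
    filter_upwards [h2, hM] with x h3 h4
    rw [norm_pow, Real.norm_eq_abs, abs_abs]
    gcongr
    exact (abs_sub _ _).trans (add_le_add h3 h4)
  · refine tendsto_order.2 ⟨fun a ha => Eventually.of_forall fun t =>
      ha.trans_le (integral_nonneg fun x => by positivity), fun a ha => ?_⟩
    obtain ⟨k, hk⟩ := exists_nat_one_div_lt ha
    have h1 : ∀ᶠ t in 𝓝[Icc 0 T \ {t | t ∈ Icc 0 T ∧ ¬ good t}] (0 : ℝ), b k t < a :=
      ((hbc k).tendsto 0).mono_left nhdsWithin_le_nhds |>.eventually_lt_const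
        ((hb0 k).trans hk)
    have h2 : ∀ᶠ t in 𝓝[Icc 0 T \ {t | t ∈ Icc 0 T ∧ ¬ good t}] (0 : ℝ), t < F.δ :=
      nhdsWithin_le_nhds (eventually_lt_nhds F.δ_pos)
    filter_upwards [h1, h2, self_mem_nhdsWithin] with t h3 h4 h5
    exact ((hmem t h5).2.2.2 h4 k).trans_lt h3

end
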